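/- Let $R>0$ and let $F$ be a complex function such that $t\mapsto F(-t)$ is analytic at every $t$ with $\operatorname{Re} t>0$ or $|t|<R$, and $F(0)=0$. Suppose that for every sufficiently large integer $N$ (the system size) $w_N:\mathbb R\to[0,\infty)$ is a bounded continuous weight function with cumulant generating function $F$, that is, for all real $t<R$ the function $\varepsilon\mapsto e^{tN\varepsilon}$ is integrable with respect to $w_N(\varepsilon)\,d\varepsilon$ and $$\langle e^{tH}\rangle=\int_{-\infty}^{\infty}e^{tN\varepsilon}\,w_N(\varepsilon)\,d\varepsilon=e^{NF(t)}\qquad(H=N\varepsilon).$$ Let $I$ be the set of real $\varepsilon$ for which the equation $\varepsilon=F'(\xi)$ has a real solution $\xi<R$. Then for every $\varepsilon\in I$ this solution $\xi=\xi(\varepsilon)$ is unique, $F(\xi)$ and $F''(\xi)$ are real with $F''(\xi)>0$, and, for each fixed $\varepsilon\in I$, as $N\to\infty$, $$w_N(\varepsilon)=\sqrt{\frac{N}{2\pi F''(\xi)}}\;e^{N[-\varepsilon\xi+F(\xi)]}+O(N^{-1/2}).$$ -/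

import Mathlib

open ProbabilityTheory MeasureTheory Filter Asymptotics Topology

/-- The measure `w(ε) dε` on the line of energy densities `ε`. -/
noncomputable def weightMeasure (w : ℝ → ℝ) : Measure ℝ :=
  volume.withDensity (fun ε => ENNReal.ofReal (w ε))

/-- `w` is a weight function for a system of size `N` with cumulant generating function `F`:
for all real `t < R` the average `⟨e^{tH}⟩` of the total energy `H = Nε`, taken with respect to
`w(ε) dε`, is finite and equals `exp (N F(t))`.
Values of `w` are pinned down pointwise by requiring continuity and boundedness. -/
structure IsExtensiveWeight (F : ℂ → ℂ) (R : ℝ) (N : ℕ) (w : ℝ → ℝ) : Prop where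
  nonneg : ∀ ε, 0 ≤ w ε
  continuous : Continuous w
  bddAbove : BddAbove (Set.range w)
  integrable_exp : ∀ t : ℝ, t < R →
    Integrable (fun ε : ℝ => Real.exp (t * ((N : ℝ) * ε))) (weightMeasure w)
  mgf_eq : ∀ t : ℝ, t < R →
    ((mgf (fun ε : ℝ => (N : ℝ) * ε) (weightMeasure w) t : ℝ) : ℂ)
      = Complex.exp ((N : ℂ) * F (t : ℂ))

/-- The energy densities `ε` for which `ε = F'(x)` has a real solution `x < R`. -/
def saddleEnergies (F : ℂ → ℂ) (R : ℝ) : Set ℝ :=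
  {ε | ∃ x : ℝ, x < R ∧ deriv F (x : ℂ) = (ε : ℂ)}

/-! The error term is absolute, not relative, and this decides the method: no contour is moved to
the saddle. By convexity `-ε ξ + F ξ` is negative unless `ξ = 0`, so away from the mean `F' 0` the
saddle term is exponentially small and only `w N ε = O(N^(-1/2))` is needed. At the mean the saddle
is the origin, already on the imaginary axis. Everything is therefore done by Fourier inversion
there.

Tails: `F` need not be analytic high on the imaginary axis, but the identity theorem gives `φ_N ^ K
= φ_K ^ N` for the characteristic functions of two sizes. Fix `K`. Since `w K` is a bounded
probability density, `φ_K` is square integrable, vanishes at infinity and has norm below one off the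
origin. So `φ_N` is dominated by `‖φ_K‖ ^ 2` times a geometric factor, and the part `|y| > δ` is
exponentially small (`exists_tail_bound`, `isBigO_sub_re_integral`).

Near the origin `φ_N = exp (N F)`, with Gaussian decay. At the mean, Laplace's method gives the main
term (`exists_abs_re_integral_sub_sqrt_le`). Elsewhere the phase is not stationary, and one
integration by parts gains a factor `1 / N` (`exists_norm_integral_le`).

Uniqueness of `ξ` and the sign of `F''` come from reading `N F''` as the variance of a tilted law.
-/

/-! ### Fourier transforms of bounded densities -/

open scoped FourierTransform in
/-- Gaussian regularisation of Fourier inversion, bounded by the supremum of the function. -/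
lemma norm_integral_fourier_mul_gaussian_le {w : ℝ → ℝ} {B : ℝ} (h0 : ∀ x, 0 ≤ w x)
    (hi : Integrable w) (hB : ∀ x, w x ≤ B) {b : ℝ} (hb : 0 < b) (x : ℝ) :
    ‖∫ y : ℝ, 𝓕 (fun u => (w u : ℂ)) y *
      Complex.exp (-(b : ℂ) * ‖y‖ ^ 2 + 2 * Real.pi * Complex.I * (inner ℝ x y : ℝ))‖ ≤ B := by
  have hbc : 0 < (b : ℂ).re := by simpa
  have hg : Integrable (fun y : ℝ => Complex.exp (-(b : ℂ) * ‖y‖ ^ 2 +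
      2 * Real.pi * Complex.I * (inner ℝ x y : ℝ))) :=
    GaussianFourier.integrable_cexp_neg_mul_sq_norm_add hbc _ _
  -- The multiplication formula moves the transform onto the Gaussian, which becomes a Gaussian
  -- kernel centred at `x` of total mass one. The integral is thus an average of `w`.
  have key := VectorFourier.integral_fourierIntegral_smul_eq_flip (L := innerₗ ℝ)
      Real.continuous_fourierChar continuous_inner (hi.ofReal (𝕜 := ℂ)) hg
  have hgauss : ∀ t : ℝ, ‖(w t : ℂ) * 𝓕 (fun y : ℝ => Complex.exp (-(b : ℂ) * ‖y‖ ^ 2 +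
      2 * Real.pi * Complex.I * (inner ℝ x y : ℝ))) t‖
      ≤ B * (√(Real.pi / b) * Real.exp (-(Real.pi ^ 2 / b) * (t - x) ^ 2)) := by
    intro t
    rw [fourier_gaussian_innerProductSpace' hbc, norm_mul, norm_mul, Complex.norm_real,
      Real.norm_of_nonneg (h0 t)]
    have h1 : ‖(Real.pi / (b : ℂ)) ^ ((Module.finrank ℝ ℝ : ℂ) / 2)‖ = √(Real.pi / b) := by
      rw [← Complex.ofReal_div, Complex.norm_cpow_eq_rpow_re_of_pos (by positivity),
        Real.sqrt_eq_rpow]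
      simp
    have h2 : ‖Complex.exp (-(Real.pi : ℂ) ^ 2 * ‖x - t‖ ^ 2 / b)‖ =
        Real.exp (-(Real.pi ^ 2 / b) * (t - x) ^ 2) := by
      rw [Complex.norm_exp]
      congr 1
      have : (-(Real.pi : ℂ) ^ 2 * ‖x - t‖ ^ 2 / b) =
          ((-(Real.pi) ^ 2 * ‖x - t‖ ^ 2 / b : ℝ) : ℂ) := by push_cast; ring
      rw [this, Complex.ofReal_re, Real.norm_eq_abs, sq_abs]
      ring
    rw [h1, h2]
    have := hB t
    gcongr
  have hint : Integrable (fun t : ℝ =>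
      B * (√(Real.pi / b) * Real.exp (-(Real.pi ^ 2 / b) * (t - x) ^ 2))) :=
    (((integrable_exp_neg_mul_sq (b := Real.pi ^ 2 / b) (by positivity)).comp_sub_right x).const_mul
      _).const_mul _
  have hval : ∫ t : ℝ, B * (√(Real.pi / b) * Real.exp (-(Real.pi ^ 2 / b) * (t - x) ^ 2)) = B := by
    rw [integral_const_mul, integral_const_mul,
      integral_sub_right_eq_self (fun t => Real.exp (-(Real.pi ^ 2 / b) * t ^ 2)) x,
      integral_gaussian, ← Real.sqrt_mul (by positivity)]
    have : Real.pi / b * (Real.pi / (Real.pi ^ 2 / b)) = 1 := by field_simp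
    rw [this]; simp
  calc _ = ‖∫ t : ℝ, (w t : ℂ) * 𝓕 (fun y : ℝ => Complex.exp (-(b : ℂ) * ‖y‖ ^ 2 +
      2 * Real.pi * Complex.I * (inner ℝ x y : ℝ))) t‖ := by
        congr 1
        simpa [smul_eq_mul] using! key
    _ ≤ ∫ t : ℝ, B * (√(Real.pi / b) * Real.exp (-(Real.pi ^ 2 / b) * (t - x) ^ 2)) :=
        norm_integral_le_of_norm_le hint (.of_forall hgauss)
    _ = B := hval

open scoped FourierTransform in
lemma conj_fourier_ofReal (w : ℝ → ℝ) (y : ℝ) :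
    (starRingEnd ℂ) (𝓕 (fun u => (w u : ℂ)) y) = 𝓕 (fun u => (w u : ℂ)) (-y) := by
  rw [Real.fourier_real_eq_integral_exp_smul, Real.fourier_real_eq_integral_exp_smul,
    ← integral_conj]
  congr 1; ext u
  simp [← Complex.exp_conj, map_ofNat]

open scoped FourierTransform in
/-- The Fourier transform of a bounded nonnegative integrable function is square integrable. -/
lemma integrable_norm_sq_fourier {w : ℝ → ℝ} {B : ℝ} (h0 : ∀ x, 0 ≤ w x)
    (hi : Integrable w) (hB : ∀ x, w x ≤ B) :
    Integrable (fun y => ‖𝓕 (fun u => (w u : ℂ)) y‖ ^ 2) := by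
  set φ := 𝓕 (fun u => (w u : ℂ)) with hφ
  have hic : Integrable (fun u => (w u : ℂ)) := hi.ofReal
  have hφc : Continuous φ :=
    VectorFourier.fourierIntegral_continuous Real.continuous_fourierChar
      (L := innerₗ ℝ) continuous_inner hic
  have hφb : ∀ y, ‖φ y‖ ≤ ∫ u, w u := fun y => by
    refine (VectorFourier.norm_fourierIntegral_le_integral_norm _ _ _ _ _).trans_eq ?_
    congr 1; ext u; simp [abs_of_nonneg (h0 u)]
  -- A bound uniform in `b`. Since `φ (-y)` is the conjugate of `φ y`, the multiplication formula
  -- turns the left side into the integral of `w` against a Gaussian smoothing of `w`, which is at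
  -- most `B`.
  have reg : ∀ b : ℝ, 0 < b → ∫ y, ‖φ y‖ ^ 2 * Real.exp (-b * y ^ 2) ≤ (∫ u, w u) * B := by
    intro b hb
    set h : ℝ → ℂ := fun y => φ (-y) * Complex.exp (-b * y ^ 2) with hh
    have hgi : Integrable (fun y : ℝ => Complex.exp (-(b : ℂ) * y ^ 2)) :=
      integrable_cexp_neg_mul_sq (by simpa)
    have hhi : Integrable h := hgi.bdd_mul (c := ∫ u, w u)
      (hφc.comp continuous_neg).aestronglyMeasurable (.of_forall fun y => hφb _)
    have key := VectorFourier.integral_fourierIntegral_smul_eq_flip (L := innerₗ ℝ)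
      Real.continuous_fourierChar continuous_inner hic hhi
    have e1 : ∫ y, φ y * h y = ∫ u, (w u : ℂ) * 𝓕 h u := by
      simpa [smul_eq_mul] using! key
    have e2 : ∫ y, φ y * h y = ((∫ y, ‖φ y‖ ^ 2 * Real.exp (-b * y ^ 2) : ℝ) : ℂ) := by
      rw [← integral_complex_ofReal]
      congr 1; ext y
      simp only [hh]
      rw [hφ, ← conj_fourier_ofReal, ← mul_assoc, Complex.mul_conj']
      push_cast; rfl
    have e3 : ∀ x, ‖𝓕 h x‖ ≤ B := by
      intro x
      refine le_trans (le_of_eq ?_) (norm_integral_fourier_mul_gaussian_le h0 hi hB hb x)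
      congr 1
      rw [Real.fourier_real_eq_integral_exp_smul, ← integral_neg_eq_self]
      congr 1; ext y
      simp only [hh, smul_eq_mul, neg_neg]
      rw [mul_left_comm, ← Complex.exp_add]
      congr 2
      have : ((‖y‖ : ℝ) : ℂ) ^ 2 = (y : ℂ) ^ 2 := by
        rw [← Complex.ofReal_pow, Real.norm_eq_abs, sq_abs]; simp
      rw [this]
      simp
      ring
    have e4 : ‖∫ u, (w u : ℂ) * 𝓕 h u‖ ≤ ∫ u, w u * B := by
      refine norm_integral_le_of_norm_le (hi.mul_const B) (.of_forall fun u => ?_)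
      rw [norm_mul, Complex.norm_real, Real.norm_of_nonneg (h0 u)]
      exact mul_le_mul_of_nonneg_left (e3 u) (h0 u)
    rw [← e1, e2, Complex.norm_real, integral_mul_const] at e4
    exact (le_abs_self _).trans e4
  refine integrable_of_intervalIntegral_norm_bounded (Real.exp 1 * ((∫ u, w u) * B))
    (a := fun n : ℕ => -(n : ℝ)) (b := fun n : ℕ => (n : ℝ)) (l := atTop)
    (fun n => ((hφc.norm.pow 2).integrableOn_Icc).mono_set Set.Ioc_subset_Icc_self)
    (tendsto_neg_atTop_atBot.comp tendsto_natCast_atTop_atTop) tendsto_natCast_atTop_atTop ?_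
  filter_upwards [eventually_gt_atTop 0] with n hn
  have hn' : (0 : ℝ) < n := by exact_mod_cast hn
  -- With `b = 1 / n ^ 2` the Gaussian factor is at least `exp (-1)` on `[-n, n]`; hence the
  -- constant `exp 1`.
  have hbpos : (0 : ℝ) < 1 / (n : ℝ) ^ 2 := by positivity
  have hgint : Integrable (fun y => ‖φ y‖ ^ 2 * Real.exp (-(1 / (n : ℝ) ^ 2) * y ^ 2)) :=
    (integrable_exp_neg_mul_sq hbpos).bdd_mul (c := (∫ u, w u) ^ 2)
      (hφc.norm.pow 2).aestronglyMeasurable (.of_forall fun y => by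
        rw [norm_pow, norm_norm]; exact pow_le_pow_left₀ (norm_nonneg _) (hφb y) 2)
  rw [intervalIntegral.integral_of_le (by linarith)]
  calc ∫ y in Set.Ioc (-(n : ℝ)) n, ‖‖φ y‖ ^ 2‖
      ≤ ∫ y in Set.Ioc (-(n : ℝ)) n,
          Real.exp 1 * (‖φ y‖ ^ 2 * Real.exp (-(1 / (n : ℝ) ^ 2) * y ^ 2)) := by
        refine setIntegral_mono_on ?_ (hgint.const_mul _).integrableOn measurableSet_Ioc ?_
        · exact ((hφc.norm.pow 2).norm.integrableOn_Icc).mono_set Set.Ioc_subset_Icc_self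
        · intro y hy
          rw [norm_pow, norm_norm, mul_left_comm, ← Real.exp_add]
          refine le_mul_of_one_le_right (by positivity) (Real.one_le_exp ?_)
          have : y ^ 2 ≤ (n : ℝ) ^ 2 := sq_le_sq' hy.1.le hy.2
          have : 1 / (n : ℝ) ^ 2 * y ^ 2 ≤ 1 := by
            rw [one_div_mul_eq_div]; exact div_le_one_of_le₀ this (by positivity)
          linarith
    _ ≤ ∫ y, Real.exp 1 * (‖φ y‖ ^ 2 * Real.exp (-(1 / (n : ℝ) ^ 2) * y ^ 2)) :=
        setIntegral_le_integral (hgint.const_mul _) (.of_forall fun y => by positivity)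
    _ ≤ Real.exp 1 * ((∫ u, w u) * B) := by
        rw [integral_const_mul]
        exact mul_le_mul_of_nonneg_left (reg _ hbpos) (Real.exp_pos 1).le

open scoped FourierTransform in
/-- Off the origin, the Fourier transform of a nonnegative density stays strictly below the mass. -/
lemma norm_fourier_lt_integral {w : ℝ → ℝ} (h0 : ∀ x, 0 ≤ w x)
    (hi : Integrable w) (hpos : 0 < ∫ x, w x) {y : ℝ} (hy : y ≠ 0) :
    ‖𝓕 (fun u => (w u : ℂ)) y‖ < ∫ x, w x := by
  set φ := 𝓕 (fun u => (w u : ℂ)) y with hφ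
  -- The phase that rotates `φ` onto the positive axis, so that `‖φ‖` is the integral of `w` against
  -- `Re e ≤ 1`.
  set c : ℂ := (starRingEnd ℂ) φ / ‖φ‖ with hc
  by_cases hz : φ = 0
  · rw [hz, norm_zero]; exact hpos
  have hn : (0 : ℝ) < ‖φ‖ := norm_pos_iff.2 hz
  have hcn : ‖c‖ = 1 := by
    rw [hc, norm_div, RCLike.norm_conj, Complex.norm_real, norm_norm, div_self hn.ne']
  have hcφ : c * φ = (‖φ‖ : ℂ) := by
    rw [hc, div_mul_eq_mul_div, Complex.conj_mul']
    have : (‖φ‖ : ℂ) ≠ 0 := by exact_mod_cast hn.ne'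
    field_simp
  set e : ℝ → ℂ := fun u => c * Complex.exp (((-2 * Real.pi * u * y : ℝ) : ℂ) * Complex.I) with he
  have hec : Continuous e := by fun_prop
  have hen : ∀ u, ‖e u‖ = 1 := fun u => by
    rw [he]; simp only []
    rw [norm_mul, hcn, Complex.norm_exp_ofReal_mul_I, one_mul]
  have hre : ∀ u, (e u).re ≤ 1 := fun u => (Complex.re_le_norm _).trans_eq (hen u)
  have hei : Integrable (fun u => e u * (w u : ℂ)) :=
    (hi.ofReal (𝕜 := ℂ)).bdd_mul (c := 1) hec.aestronglyMeasurable (.of_forall fun u => (hen u).le)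
  have hrei : Integrable (fun u => (e u).re * w u) := by
    have := hei.re
    refine this.congr (.of_forall fun u => ?_)
    simp
  have heq : ‖φ‖ = ∫ u, (e u).re * w u := by
    have h1 : (∫ u, e u * (w u : ℂ)) = (‖φ‖ : ℂ) := by
      rw [← hcφ, hφ, Real.fourier_real_eq_integral_exp_smul, ← integral_const_mul]
      congr 1; ext u
      simp only [he, smul_eq_mul, mul_assoc]
    have h2 := congrArg Complex.re h1
    rw [Complex.ofReal_re] at h2
    rw [← h2]
    have := integral_re hei
    simp only [RCLike.re_to_complex] at this
    rw [← this]
    congr 1; ext u; simp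
  refine lt_of_le_of_ne ?_ fun hcontra => ?_
  · rw [heq]
    exact integral_mono hrei hi fun u => mul_le_of_le_one_left (h0 u) (hre u)
  -- Equality forces `e = 1` almost everywhere that `w ≠ 0`. As `y ≠ 0`, `e = 1` holds only on a
  -- countable set, so `w` would vanish almost everywhere.
  have hzero : ∫ u, (w u - (e u).re * w u) = 0 := by
    rw [integral_sub hi hrei, ← heq, hcontra, sub_self]
  have hae := (integral_eq_zero_iff_of_nonneg
    (fun u => sub_nonneg.2 (mul_le_of_le_one_left (h0 u) (hre u))) (hi.sub hrei)).1 hzero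
  have hcount : Set.Countable {u : ℝ | e u = 1} := by
    by_cases hne : ({u : ℝ | e u = 1}).Nonempty
    · obtain ⟨u₀, hu₀⟩ := hne
      refine (Set.countable_range fun n : ℤ => u₀ - n / y).mono fun u hu => ?_
      have h1 : Complex.exp (((-2 * Real.pi * u * y : ℝ) : ℂ) * Complex.I) =
          Complex.exp (((-2 * Real.pi * u₀ * y : ℝ) : ℂ) * Complex.I) := by
        have hc0 : c ≠ 0 := by rw [← norm_ne_zero_iff, hcn]; exact one_ne_zero
        exact mul_left_cancel₀ hc0 ((show e u = 1 from hu).trans (show e u₀ = 1 from hu₀).symm)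
      obtain ⟨n, hn⟩ := Complex.exp_eq_exp_iff_exists_int.1 h1
      refine ⟨n, ?_⟩
      have h2 := congrArg Complex.im hn
      simp at h2
      have h3 : (u₀ - u) * y = n := by
        have := Real.pi_pos
        have h4 : 2 * Real.pi * ((u₀ - u) * y) = 2 * Real.pi * n := by linarith
        exact mul_left_cancel₀ (by positivity) h4
      simp only []
      rw [← h3]; field_simp; ring
    · rw [Set.not_nonempty_iff_eq_empty.1 hne]; exact Set.countable_empty
  have hw0 : w =ᵐ[volume] 0 := by
    have hnull : ∀ᵐ u : ℝ, u ∉ {u : ℝ | e u = 1} := hcount.ae_notMem _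
    filter_upwards [hae, hnull] with u hu hne
    by_contra hwu
    apply hne
    have h1 : (e u).re = 1 := by
      have : (1 - (e u).re) * w u = 0 := by simp at hu; linarith
      rcases mul_eq_zero.1 this with h | h
      · linarith
      · exact absurd h hwu
    have h2 := Complex.sq_norm_sub_sq_re (e u)
    rw [hen, h1] at h2
    have h3 : (e u).im = 0 := by nlinarith
    exact Complex.ext (by simpa using h1) (by simpa using h3)
  rw [integral_congr_ae hw0] at hpos
  simp at hpos

/-! ### Exponentially small tails -/

/-- A continuous function vanishing at infinity with norm below one off the origin is
bounded away from one outside a neighbourhood of the origin. -/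
lemma exists_norm_le_lt_one {φ : ℝ → ℂ} (hc : Continuous φ) (hlt : ∀ y, y ≠ 0 → ‖φ y‖ < 1)
    (hinf : Tendsto φ (cocompact ℝ) (𝓝 0)) {δ : ℝ} (hδ : 0 < δ) :
    ∃ q : ℝ, 0 < q ∧ q < 1 ∧ ∀ y, δ ≤ |y| → ‖φ y‖ ≤ q := by
  have h1 : ∀ᶠ y in cocompact ℝ, ‖φ y‖ < 1 / 2 := by
    have := hinf.norm
    rw [norm_zero] at this
    exact this.eventually_lt_const (by norm_num)
  rw [← Metric.cobounded_eq_cocompact, Filter.Eventually,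
    (Metric.hasBasis_cobounded_compl_closedBall (0 : ℝ)).mem_iff] at h1
  obtain ⟨A, -, hA⟩ := h1
  have hS : IsCompact (Metric.closedBall (0 : ℝ) (max A δ) ∩ {y | δ ≤ |y|}) :=
    (isCompact_closedBall _ _).inter_right (isClosed_le continuous_const continuous_abs)
  have hne : (Metric.closedBall (0 : ℝ) (max A δ) ∩ {y | δ ≤ |y|}).Nonempty :=
    ⟨δ, by simp [abs_of_pos hδ]⟩
  obtain ⟨y₀, hy₀, hmax⟩ := hS.exists_isMaxOn hne hc.norm.continuousOn
  have hy₀0 : y₀ ≠ 0 := by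
    rintro rfl
    have := hy₀.2
    simp at this; linarith
  refine ⟨max (1 / 2) ‖φ y₀‖, by positivity, max_lt (by norm_num) (hlt _ hy₀0), fun y hy => ?_⟩
  by_cases hyA : |y| ≤ max A δ
  · exact le_max_of_le_right (hmax ⟨by simpa using hyA, hy⟩)
  · refine le_max_of_le_left (le_of_lt (hA ?_))
    have : A < |y| := (le_max_left _ _).trans_lt (not_le.1 hyA)
    simpa using this

/-- If `a ^ K = b ^ N`, then `a` is at most `b ^ 2` times the `N - 2K`-th power of a bound
for the `K`-th root of `b`. -/
lemma le_sq_mul_pow_of_pow_eq {a b q : ℝ} {K N : ℕ} (hK : K ≠ 0) (hN : 2 * K ≤ N)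
    (hb : 0 ≤ b) (hq : 0 ≤ q) (hbq : b ≤ q ^ K) (h : a ^ K = b ^ N) :
    a ≤ b ^ 2 * q ^ (N - 2 * K) := by
  -- The factor `b ^ 2` is set aside to supply integrability; the remaining `N - 2K` powers of `b`
  -- supply the decay.
  refine le_of_pow_le_pow_left₀ hK (by positivity) ?_
  calc a ^ K = b ^ (2 * K) * b ^ (N - 2 * K) := by rw [h, ← pow_add]; congr 1; omega
    _ ≤ b ^ (2 * K) * (q ^ K) ^ (N - 2 * K) := by gcongr
    _ = _ := by rw [mul_pow, ← pow_mul, ← pow_mul, ← pow_mul, mul_comm K (N - 2 * K)]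

/-- Integrability and exponential smallness away from the origin for a family of functions
whose members are, up to roots of unity, the powers of one function. -/
lemma exists_tail_bound {φ : ℕ → ℝ → ℂ} {K : ℕ} (hK : K ≠ 0)
    (hc : ∀ N, K ≤ N → Continuous (φ N)) (hpow : ∀ N, K ≤ N → ∀ y, φ N y ^ K = φ K y ^ N)
    (hle : ∀ y, ‖φ K y‖ ≤ 1) (hlt : ∀ y, y ≠ 0 → ‖φ K y‖ < 1)
    (hinf : Tendsto (φ K) (cocompact ℝ) (𝓝 0)) (hL2 : Integrable (fun y => ‖φ K y‖ ^ 2))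
    {δ : ℝ} (hδ : 0 < δ) :
    ∃ q C : ℝ, 0 < q ∧ q < 1 ∧ ∀ N, 2 * K ≤ N → Integrable (φ N) ∧
      ∫ y in (Set.Icc (-δ) δ)ᶜ, ‖φ N y‖ ≤ C * q ^ N := by
  obtain ⟨q₀, hq0, hq1, hq⟩ := exists_norm_le_lt_one (hc K le_rfl) hlt hinf hδ
  have hpown : ∀ N, K ≤ N → ∀ y, ‖φ N y‖ ^ K = ‖φ K y‖ ^ N := fun N hN y => by
    rw [← norm_pow, hpow N hN, norm_pow]
  set q := q₀ ^ (1 / (K : ℝ)) with hqdef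
  have hqpos : 0 < q := by positivity
  have hqK : q ^ K = q₀ := by
    rw [hqdef, one_div]; exact Real.rpow_inv_natCast_pow hq0.le hK
  have hqlt : q < 1 := by
    by_contra hcon
    have := one_le_pow₀ (n := K) (not_lt.1 hcon)
    linarith
  refine ⟨q, (∫ y, ‖φ K y‖ ^ 2) / q ^ (2 * K), hqpos, hqlt, fun N hN => ⟨?_, ?_⟩⟩
  -- Over the whole line only the trivial bound `q = 1` is available, and it already gives
  -- domination by `‖φ K y‖ ^ 2`.
  · refine hL2.mono' (hc N (by omega)).aestronglyMeasurable (.of_forall fun y => ?_)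
    simpa using le_sq_mul_pow_of_pow_eq hK hN (norm_nonneg _) zero_le_one
      (by simpa using hle y) (hpown N (by omega) y)
  · have hb : ∀ᵐ y ∂(volume.restrict (Set.Icc (-δ) δ)ᶜ),
        ‖‖φ N y‖‖ ≤ ‖φ K y‖ ^ 2 * q ^ (N - 2 * K) := by
      simp only [norm_norm]
      refine (ae_restrict_iff' measurableSet_Icc.compl).2 (.of_forall fun y hy => ?_)
      refine le_sq_mul_pow_of_pow_eq hK hN (norm_nonneg _) hqpos.le ?_ (hpown N (by omega) y)
      rw [hqK]
      refine hq y ?_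
      by_contra hcon
      exact hy ((abs_lt.1 (not_le.1 hcon)).imp le_of_lt le_of_lt)
    calc _ ≤ ∫ y in (Set.Icc (-δ) δ)ᶜ, ‖φ K y‖ ^ 2 * q ^ (N - 2 * K) :=
          (Real.le_norm_self _).trans
            (norm_integral_le_of_norm_le (hL2.mul_const _).integrableOn hb)
      _ ≤ ∫ y, ‖φ K y‖ ^ 2 * q ^ (N - 2 * K) :=
          setIntegral_le_integral (hL2.mul_const _) (.of_forall fun y => by positivity)
      _ = _ := by
          have : q ^ N = q ^ (N - 2 * K) * q ^ (2 * K) := by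
            rw [← pow_add, Nat.sub_add_cancel hN]
          rw [integral_mul_const, this]
          field_simp

/-! ### Characteristic functions and Fourier inversion -/

/-- Complex exponential integrals against `weightMeasure w`. -/
lemma integral_weightMeasure {w : ℝ → ℝ} (h0 : ∀ x, 0 ≤ w x) (hc : Continuous w) (g : ℝ → ℂ) :
    ∫ x, g x ∂(weightMeasure w) = ∫ x, g x * w x := by
  rw [weightMeasure, integral_withDensity_eq_integral_toReal_smul
    (hc.measurable.ennreal_ofReal) (.of_forall fun x => ENNReal.ofReal_lt_top)]
  congr 1; ext x
  rw [ENNReal.toReal_ofReal (h0 x), Complex.real_smul, mul_comm]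

open scoped FourierTransform in
/-- On the imaginary axis the complex moment generating function is a rescaled Fourier transform. -/
lemma complexMGF_weightMeasure_mul_I {w : ℝ → ℝ} (h0 : ∀ x, 0 ≤ w x) (hc : Continuous w)
    (N : ℝ) (y : ℝ) :
    complexMGF (fun ε : ℝ => N * ε) (weightMeasure w) (y * Complex.I) =
      𝓕 (fun u => (w u : ℂ)) (-(N / (2 * Real.pi)) * y) := by
  rw [complexMGF, integral_weightMeasure h0 hc, Real.fourier_real_eq_integral_exp_smul]
  congr 1; ext x
  rw [smul_eq_mul]
  congr 2
  have : (Real.pi : ℂ) ≠ 0 := by exact_mod_cast Real.pi_ne_zero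
  push_cast
  field_simp

open scoped FourierTransform in
/-- Fourier inversion for the weight of an extensive variable. -/
lemma eq_integral_complexMGF {w : ℝ → ℝ} (h0 : ∀ x, 0 ≤ w x) (hc : Continuous w)
    (hi : Integrable w) {N : ℝ} (hN : 0 < N)
    (hint : Integrable fun y : ℝ =>
      complexMGF (fun ε : ℝ => N * ε) (weightMeasure w) (y * Complex.I)) (ε : ℝ) :
    (w ε : ℂ) = N / (2 * Real.pi) * ∫ y : ℝ,
      complexMGF (fun ε : ℝ => N * ε) (weightMeasure w) (y * Complex.I) *
        Complex.exp (-(N * ε * y * Complex.I)) := by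
  set a : ℝ := -(N / (2 * Real.pi)) with ha
  have hapos : 0 < N / (2 * Real.pi) := by positivity
  have ha0 : a ≠ 0 := by rw [ha]; exact neg_ne_zero.2 hapos.ne'
  simp_rw [complexMGF_weightMeasure_mul_I h0 hc, ← ha] at hint ⊢
  have hFi : Integrable (𝓕 (fun u => (w u : ℂ))) := (integrable_comp_mul_left_iff _ ha0).1 hint
  have hcc : Continuous (fun u => (w u : ℂ)) := by fun_prop
  have hinv := congrFun (hcc.fourierInv_fourier_eq hi.ofReal hFi) ε
  rw [← hinv, Real.fourierInv_eq']
  have := Measure.integral_comp_mul_left (fun v : ℝ =>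
    Complex.exp (((2 * Real.pi * inner ℝ v ε : ℝ) : ℂ) * Complex.I) •
      𝓕 (fun u => (w u : ℂ)) v) a
  have habs : |a⁻¹| = (N / (2 * Real.pi))⁻¹ := by rw [ha, abs_inv, abs_neg, abs_of_pos hapos]
  rw [habs] at this
  have h2 : ∫ y : ℝ, 𝓕 (fun u => (w u : ℂ)) (a * y) * Complex.exp (-(N * ε * y * Complex.I)) =
      ∫ y : ℝ, Complex.exp (((2 * Real.pi * inner ℝ (a * y) ε : ℝ) : ℂ) * Complex.I) •
        𝓕 (fun u => (w u : ℂ)) (a * y) := by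
    congr 1; ext y
    rw [smul_eq_mul, mul_comm]
    congr 2
    have : (Real.pi : ℂ) ≠ 0 := by exact_mod_cast Real.pi_ne_zero
    simp [ha]
    field_simp
  rw [h2, this, Complex.real_smul, ← mul_assoc]
  have h3 : (N : ℂ) / (2 * Real.pi) * (((N / (2 * Real.pi))⁻¹ : ℝ) : ℂ) = 1 := by
    rw [← Complex.ofReal_ofNat, ← Complex.ofReal_mul, ← Complex.ofReal_div, ← Complex.ofReal_mul,
      mul_inv_cancel₀ hapos.ne', Complex.ofReal_one]
  rw [h3, one_mul]

/-! ### Behaviour of `F` on the imaginary axis near the origin -/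

/-- The derivative of a function that is real on the real line near a point is real there. -/
lemma im_deriv_eq_zero {F : ℂ → ℂ} {x : ℝ} (hF : AnalyticAt ℂ F x)
    (hre : ∀ᶠ t : ℝ in 𝓝 x, (F t).im = 0) : (deriv F x).im = 0 := by
  have h1 := hF.differentiableAt.hasDerivAt.comp_ofReal
  have h2 := Complex.imCLM.hasFDerivAt.comp_hasDerivAt x h1
  have h3 : (Complex.imCLM ∘ fun y : ℝ => F y) =ᶠ[𝓝 x] fun _ => (0 : ℝ) := hre
  have h4 := (hasDerivAt_const x (0 : ℝ)).congr_of_eventuallyEq h3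
  exact h2.unique h4

/-- All derivatives of a function that is real on the real line near a point are real there. -/
lemma eventually_im_iteratedDeriv_eq_zero {F : ℂ → ℂ} {x : ℝ} (hF : AnalyticAt ℂ F x)
    (hre : ∀ᶠ t : ℝ in 𝓝 x, (F t).im = 0) (n : ℕ) :
    ∀ᶠ t : ℝ in 𝓝 x, (iteratedDeriv n F t).im = 0 := by
  induction n with
  | zero => simpa using hre
  | succ n ih =>
    have han : ∀ᶠ t : ℝ in 𝓝 x, AnalyticAt ℂ F t :=
      Complex.continuous_ofReal.continuousAt.eventually hF.eventually_analyticAt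
    filter_upwards [ih.eventually_nhds, han] with t ht hat
    rw [iteratedDeriv_succ]
    rw [iteratedDeriv_eq_iterate] at ht ⊢
    exact im_deriv_eq_zero (hat.iterated_deriv n) ht

/-- The Taylor coefficients are real, so at `y * I` the even orders go to the real part and the odd
orders to the imaginary part. The cubic term thus affects only the phase, with `κ = -F'''(0) / 6`
because `I ^ 3 = -I`. -/
lemma exists_taylor_bound {F : ℂ → ℂ} (hF : AnalyticAt ℂ F 0) (hF0 : F 0 = 0)
    (hre : ∀ᶠ t : ℝ in 𝓝 0, (F t).im = 0) :
    ∃ κ δ C : ℝ, 0 < δ ∧ 0 < C ∧ ∀ y : ℝ, |y| ≤ δ →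
      |(F (y * Complex.I)).re + (iteratedDeriv 2 F 0).re * y ^ 2 / 2| ≤ C * y ^ 4 ∧
      |(F (y * Complex.I)).im - (deriv F 0).re * y - κ * y ^ 3| ≤ C * y ^ 4 := by
  have h := hF.hasFPowerSeriesAt.isBigO_sub_partialSum_pow 4
  obtain ⟨C, hC, h⟩ := h.exists_pos
  have h' := h.bound
  have hcont : Tendsto (fun y : ℝ => (y : ℂ) * Complex.I) (𝓝 0) (𝓝 0) := by
    have : Continuous (fun y : ℝ => (y : ℂ) * Complex.I) := by fun_prop
    simpa using this.tendsto 0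
  obtain ⟨δ, hδ, hb⟩ := Metric.eventually_nhds_iff.1 (hcont.eventually h')
  have him : ∀ n, (iteratedDeriv n F 0).im = 0 := fun n => by
    have := (eventually_im_iteratedDeriv_eq_zero (x := 0) (by simpa using hF) hre n).self_of_nhds
    simpa using this
  have hreal : ∀ n, iteratedDeriv n F 0 = ((iteratedDeriv n F 0).re : ℂ) := fun n =>
    Complex.ext (by simp) (by simp [him n])
  refine ⟨-(iteratedDeriv 3 F 0).re / 6, δ / 2, C, by positivity, hC, fun y hy => ?_⟩
  have hy' := hb (y := y) (by simpa using by linarith)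
  have e4 : ‖‖(y : ℂ) * Complex.I‖ ^ 4‖ = y ^ 4 := by
    simp [pow_abs, abs_of_nonneg (show 0 ≤ y ^ 4 by positivity)]
  rw [e4] at hy'
  set a1 := (deriv F 0).re with ha1
  set a2 := (iteratedDeriv 2 F 0).re with ha2
  set a3 := (iteratedDeriv 3 F 0).re with ha3
  have h1 : deriv F 0 = a1 := by simpa using hreal 1
  have h2 : iteratedDeriv 2 F 0 = a2 := hreal 2
  have h3 : iteratedDeriv 3 F 0 = a3 := hreal 3
  have e5 : F (0 + (y : ℂ) * Complex.I) - (FormalMultilinearSeries.ofScalars ℂ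
      (fun n ↦ iteratedDeriv n F 0 / n.factorial)).partialSum 4 ((y : ℂ) * Complex.I) =
      F (y * Complex.I) + ((a2 * y ^ 2 / 2 : ℝ) : ℂ)
        - ((a1 * y + -a3 / 6 * y ^ 3 : ℝ) : ℂ) * Complex.I := by
    have i2 : Complex.I ^ 2 = -1 := Complex.I_sq
    have i3 : Complex.I ^ 3 = -Complex.I := by rw [pow_succ, i2]; ring
    simp [FormalMultilinearSeries.partialSum, Finset.sum_range_succ,
      hF0, h1, h2, h3, Nat.factorial, mul_pow, i2, i3]
    ring
  rw [e5] at hy'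
  constructor
  · refine le_trans (le_of_eq ?_) ((Complex.abs_re_le_norm _).trans hy')
    simp only [Complex.add_re, Complex.sub_re, Complex.re_ofReal_mul, Complex.ofReal_re,
      Complex.I_re, mul_zero, sub_zero]
  · refine le_trans (le_of_eq ?_) ((Complex.abs_im_le_norm _).trans hy')
    simp only [Complex.add_im, Complex.sub_im, Complex.im_ofReal_mul, Complex.ofReal_im,
      Complex.I_im, mul_one, add_zero]
    congr 1; ring

/-- Gaussian decay of `exp (N F)` along the imaginary axis close to the origin. -/
lemma exists_gaussian_bound {F : ℂ → ℂ} (hF : AnalyticAt ℂ F 0) (hF0 : F 0 = 0)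
    (hre : ∀ᶠ t : ℝ in 𝓝 0, (F t).im = 0) (hσ : 0 < (iteratedDeriv 2 F 0).re) :
    ∃ δ C : ℝ, 0 < δ ∧ 0 < C ∧ ∀ y : ℝ, |y| ≤ δ →
      (F (y * Complex.I)).re ≤ -((iteratedDeriv 2 F 0).re / 4 * y ^ 2) ∧
      |(F (y * Complex.I)).re + (iteratedDeriv 2 F 0).re * y ^ 2 / 2| ≤ C * y ^ 4 ∧
      |(F (y * Complex.I)).im - (deriv F 0).re * y| ≤ C * |y| ^ 3 := by
  obtain ⟨κ, δ, C, hδ, hC, h⟩ := exists_taylor_bound hF hF0 hre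
  set s := (iteratedDeriv 2 F 0).re
  -- `|y| ≤ 1` lets the quartic error be absorbed in a cubic one; together with `|y| ≤ s / (4 * C)`
  -- it makes the quartic error at most half of the quadratic term.
  refine ⟨min δ (min 1 (s / (4 * C))), |κ| + C, by positivity, by positivity, fun y hy => ?_⟩
  obtain ⟨ha, hb⟩ := h y (hy.trans (min_le_left _ _))
  have hy1 : |y| ≤ 1 := hy.trans ((min_le_right _ _).trans (min_le_left _ _))
  have hy2 : |y| ≤ s / (4 * C) := hy.trans ((min_le_right _ _).trans (min_le_right _ _))
  have hyy : y ^ 2 = |y| ^ 2 := (sq_abs y).symm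
  have hy4 : y ^ 4 = |y| ^ 4 := by rw [show y ^ 4 = (y ^ 2) ^ 2 by ring, hyy]; ring
  have h0 := abs_nonneg y
  have hCy : C * y ^ 4 ≤ s / 4 * y ^ 2 := by
    have h1 : C * |y| ≤ s / 4 := by
      rw [le_div_iff₀ (by positivity)] at hy2; linarith
    have h2 : C * |y| ^ 2 ≤ s / 4 := by nlinarith
    calc C * y ^ 4 = C * |y| ^ 2 * y ^ 2 := by rw [hy4, hyy]; ring
      _ ≤ s / 4 * y ^ 2 := by gcongr
  refine ⟨?_, ?_, ?_⟩
  · have := (abs_le.1 ha).2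
    linarith
  · refine ha.trans ?_
    have := abs_nonneg κ
    gcongr; linarith
  · have h3 : |κ * y ^ 3| = |κ| * |y| ^ 3 := by rw [abs_mul, abs_pow]
    have h4 : C * y ^ 4 ≤ C * |y| ^ 3 := by
      rw [hy4]
      exact mul_le_mul_of_nonneg_left (pow_le_pow_of_le_one h0 hy1 (by norm_num)) hC.le
    calc _ = |((F (y * Complex.I)).im - (deriv F 0).re * y - κ * y ^ 3) + κ * y ^ 3| := by
          congr 1; ring
      _ ≤ C * y ^ 4 + |κ| * |y| ^ 3 := (abs_add_le _ _).trans (by rw [h3]; gcongr)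
      _ ≤ _ := by linarith

/-! ### Laplace's method at the mean -/

/-- Pointwise comparison of a perturbed oscillating Gaussian with the Gaussian. -/
lemma abs_exp_mul_cos_sub_exp_le {A B s N C y : ℝ} (hs : 0 < s) (hN : 0 < N) (hC : 0 < C)
    (h1 : A ≤ -(s / 4 * y ^ 2)) (h2 : |A + s * y ^ 2 / 2| ≤ C * y ^ 4) (h3 : |B| ≤ C * |y| ^ 3) :
    |Real.exp (N * A) * Real.cos (N * B) - Real.exp (-(N * s / 2) * y ^ 2)| ≤
      (128 * C / s ^ 2 + 1536 * C ^ 2 / s ^ 3) / N * Real.exp (-(N * s / 8) * y ^ 2) := by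
  -- In this unit the Gaussian is `exp (-4x)`, the perturbed modulus is at most `exp (-2x)` and the
  -- target is `exp (-x)`. The spare `exp (-x)` pays for `x ^ 2` and `x ^ 3` through `x ^ n ≤ n! *
  -- exp x`, whence `128 = 64 * 2!` and `1536 = 256 * 3!`.
  set x := N * s / 8 * y ^ 2 with hx
  have hx0 : 0 ≤ x := by positivity
  have hy2 : y ^ 2 = 8 * x / (N * s) := by rw [hx]; field_simp
  have hA : Real.exp (N * A) ≤ Real.exp (-(2 * x)) := by
    apply Real.exp_le_exp.2
    calc N * A ≤ N * (-(s / 4 * y ^ 2)) := by gcongr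
      _ = -(2 * x) := by rw [hx]; ring
  have hG : Real.exp (-(N * s / 2) * y ^ 2) = Real.exp (-(4 * x)) := by rw [hx]; ring_nf
  have hE : Real.exp (-(N * s / 8) * y ^ 2) = Real.exp (-x) := by rw [hx]; ring_nf
  have hmono : Real.exp (-(4 * x)) ≤ Real.exp (-(2 * x)) := Real.exp_le_exp.2 (by linarith)
  have hdiff : |Real.exp (N * A) - Real.exp (-(4 * x))| ≤ Real.exp (-(2 * x)) * (N * (C * y ^ 4)) := by
    have gen : ∀ a b : ℝ, Real.exp a - Real.exp b ≤ Real.exp a * |a - b| := fun a b => by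
      have h := Real.add_one_le_exp (b - a)
      have h' : Real.exp b = Real.exp a * Real.exp (b - a) := by rw [← Real.exp_add]; ring_nf
      have := Real.exp_pos a
      have := le_abs_self (a - b)
      rw [h']; nlinarith
    have hab : |N * A - -(4 * x)| ≤ N * (C * y ^ 4) := by
      have : N * A - -(4 * x) = N * (A + s * y ^ 2 / 2) := by rw [hx]; ring
      rw [this, abs_mul, abs_of_pos hN]; gcongr
    rw [abs_le']
    constructor
    · exact (gen _ _).trans (by gcongr)
    · rw [neg_sub]
      refine (gen _ _).trans ?_
      rw [abs_sub_comm]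
      gcongr
  -- Having taken the real part, the cubic phase enters only through its square. At `y` of order
  -- `N^(-1/2)` this costs `1 / N` instead of `N^(-1/2)`.
  have hcos : |Real.exp (N * A) * Real.cos (N * B) - Real.exp (N * A)| ≤
      Real.exp (-(2 * x)) * (N ^ 2 * C ^ 2 * y ^ 6 / 2) := by
    have h4 := Real.one_sub_sq_div_two_le_cos (x := N * B)
    have h5 := Real.cos_le_one (N * B)
    have h6 : (N * B) ^ 2 / 2 ≤ N ^ 2 * C ^ 2 * y ^ 6 / 2 := by
      have : (N * B) ^ 2 ≤ N ^ 2 * (C * |y| ^ 3) ^ 2 := by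
        rw [mul_pow, ← sq_abs B]; gcongr
      have h7 : (C * |y| ^ 3) ^ 2 = C ^ 2 * y ^ 6 := by
        rw [mul_pow, ← pow_mul, show 3 * 2 = 2 * 3 by norm_num, pow_mul, sq_abs]; ring
      rw [h7] at this
      linarith
    rw [← mul_sub_one, abs_mul, abs_of_pos (Real.exp_pos _)]
    refine mul_le_mul hA ?_ (abs_nonneg _) (Real.exp_pos _).le
    rw [abs_sub_comm, abs_of_nonneg (by linarith)]
    linarith
  have hx2 : x ^ 2 ≤ 2 * Real.exp x := by
    have := Real.pow_div_factorial_le_exp x hx0 2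
    norm_num [Nat.factorial] at this; linarith
  have hx3 : x ^ 3 ≤ 6 * Real.exp x := by
    have := Real.pow_div_factorial_le_exp x hx0 3
    norm_num [Nat.factorial] at this; linarith
  have hexp : Real.exp (-(2 * x)) * Real.exp x = Real.exp (-x) := by
    rw [← Real.exp_add]; ring_nf
  have e4 : N * (C * y ^ 4) = 64 * C / (s ^ 2 * N) * x ^ 2 := by
    rw [show y ^ 4 = (y ^ 2) ^ 2 by ring, hy2]; field_simp; ring
  have e6 : N ^ 2 * C ^ 2 * y ^ 6 / 2 = 256 * C ^ 2 / (s ^ 3 * N) * x ^ 3 := by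
    rw [show y ^ 6 = (y ^ 2) ^ 3 by ring, hy2]; field_simp; ring
  rw [hG, hE]
  calc _ = |(Real.exp (N * A) * Real.cos (N * B) - Real.exp (N * A)) +
          (Real.exp (N * A) - Real.exp (-(4 * x)))| := by congr 1; ring
    _ ≤ Real.exp (-(2 * x)) * (256 * C ^ 2 / (s ^ 3 * N) * x ^ 3) +
        Real.exp (-(2 * x)) * (64 * C / (s ^ 2 * N) * x ^ 2) := by
        rw [← e4, ← e6]; exact (abs_add_le _ _).trans (add_le_add hcos hdiff)
    _ ≤ Real.exp (-(2 * x)) * (256 * C ^ 2 / (s ^ 3 * N) * (6 * Real.exp x)) +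
        Real.exp (-(2 * x)) * (64 * C / (s ^ 2 * N) * (2 * Real.exp x)) := by gcongr
    _ = (1536 * C ^ 2 / (s ^ 3 * N) + 128 * C / (s ^ 2 * N)) *
        (Real.exp (-(2 * x)) * Real.exp x) := by ring
    _ = _ := by rw [hexp]; field_simp; ring

lemma integral_gaussian_mul_nat {c N : ℝ} (hc : 0 < c) (hN : 0 < N) :
    ∫ y : ℝ, Real.exp (-(N * c) * y ^ 2) = √(Real.pi / c) * N ^ (-(1 / 2) : ℝ) := by
  rw [integral_gaussian, Real.rpow_neg hN.le, ← Real.sqrt_eq_rpow, ← Real.sqrt_inv,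
    ← Real.sqrt_mul (by positivity)]
  congr 1
  field_simp

/-- Laplace asymptotics for the real part of the local inversion integral at its saddle point. -/
lemma exists_abs_re_integral_sub_sqrt_le {F : ℂ → ℂ} {s μ δ C : ℝ} (hs : 0 < s) (hδ : 0 < δ)
    (hC : 0 < C) (hcont : ContinuousOn (fun y : ℝ => F (y * Complex.I)) (Set.Icc (-δ) δ))
    (h : ∀ y : ℝ, |y| ≤ δ →
      (F (y * Complex.I)).re ≤ -(s / 4 * y ^ 2) ∧
      |(F (y * Complex.I)).re + s * y ^ 2 / 2| ≤ C * y ^ 4 ∧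
      |(F (y * Complex.I)).im - μ * y| ≤ C * |y| ^ 3) :
    ∃ D : ℝ, ∀ N : ℝ, 1 ≤ N →
      |(N / (2 * Real.pi) * ∫ y in Set.Icc (-δ) δ,
          Complex.exp (N * F (y * Complex.I)) * Complex.exp (-(N * μ * y * Complex.I))).re -
        √(N / (2 * Real.pi * s))| ≤ D * N ^ (-(1 / 2) : ℝ) := by
  -- `K₀` is the error inside `[-δ, δ]`. `K₁` pays for the Gaussian outside, where the integrand is
  -- extended by zero. Their `1 / N` cancels the prefactor `N`, and the Gaussian width leaves
  -- `N^(-1/2)`.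
  set K₀ : ℝ := 128 * C / s ^ 2 + 1536 * C ^ 2 / s ^ 3
  set K₁ : ℝ := 8 / (s * δ ^ 2)
  set K := K₀ + K₁
  refine ⟨K / (2 * Real.pi) * √(Real.pi / (s / 8)), fun N hN => ?_⟩
  have hN0 : 0 < N := by linarith
  have hK₀ : 0 ≤ K₀ := by positivity
  have hK₁ : 0 ≤ K₁ := by positivity
  set f : ℝ → ℂ := fun y =>
    Complex.exp (N * F (y * Complex.I)) * Complex.exp (-(N * μ * y * Complex.I)) with hf
  have hfc : ContinuousOn f (Set.Icc (-δ) δ) := by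
    refine ((continuousOn_const.mul hcont).cexp).mul (Continuous.continuousOn (by fun_prop))
  have hfi : IntegrableOn f (Set.Icc (-δ) δ) := hfc.integrableOn_Icc
  set g : ℝ → ℝ := (Set.Icc (-δ) δ).indicator fun y => (f y).re with hg
  have hgi : Integrable g := by
    rw [hg, integrable_indicator_iff measurableSet_Icc]
    exact hfi.re
  have hgint : ∫ y, g y = (∫ y in Set.Icc (-δ) δ, f y).re := by
    rw [hg, integral_indicator measurableSet_Icc]
    exact integral_re hfi
  have hre : ∀ y, (f y).re = Real.exp (N * (F (y * Complex.I)).re) *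
      Real.cos (N * ((F (y * Complex.I)).im - μ * y)) := fun y => by
    rw [hf]
    simp only []
    rw [← Complex.exp_add, Complex.exp_re]
    congr 2
    · simp
    · simp; ring
  have hpt : ∀ y, |g y - Real.exp (-(N * s / 2) * y ^ 2)| ≤
      K / N * Real.exp (-(N * (s / 8)) * y ^ 2) := by
    intro y
    by_cases hy : y ∈ Set.Icc (-δ) δ
    · obtain ⟨h1, h2, h3⟩ := h y (abs_le.2 hy)
      rw [hg, Set.indicator_of_mem hy, hre]
      refine (abs_exp_mul_cos_sub_exp_le hs hN0 hC h1 h2 h3).trans ?_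
      rw [mul_div_assoc N s 8]
      gcongr
      linarith
    · rw [hg, Set.indicator_of_notMem hy, zero_sub, abs_neg, abs_of_pos (Real.exp_pos _)]
      have hyδ : δ ^ 2 ≤ y ^ 2 := by
        rw [← sq_abs y]
        exact pow_le_pow_left₀ hδ.le (not_le.1 fun hcon => hy (abs_le.1 hcon)).le 2
      set x := N * (s / 8) * y ^ 2 with hx
      have hx0 : 0 ≤ x := by positivity
      have hxe : Real.exp (-(N * s / 2) * y ^ 2) = Real.exp (-(3 * x)) * Real.exp (-x) := by
        rw [← Real.exp_add, hx]; ring_nf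
      rw [hxe, neg_mul, ← hx]
      refine mul_le_mul_of_nonneg_right ?_ (Real.exp_pos _).le
      have hlow : N * (s / 8) * δ ^ 2 ≤ x := by rw [hx]; gcongr
      have h1 : 3 * x + 1 ≤ Real.exp (3 * x) := Real.add_one_le_exp _
      have h2 : Real.exp (-(3 * x)) ≤ 1 / (N * (s / 8) * δ ^ 2) := by
        rw [Real.exp_neg, inv_eq_one_div]
        exact one_div_le_one_div_of_le (by positivity) (by linarith)
      refine h2.trans ?_
      calc 1 / (N * (s / 8) * δ ^ 2) = K₁ / N := by simp only [K₁]; field_simp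
        _ ≤ K / N := by gcongr; exact le_add_of_nonneg_left hK₀
  have hGi : Integrable fun y : ℝ => Real.exp (-(N * s / 2) * y ^ 2) :=
    integrable_exp_neg_mul_sq (by positivity)
  have hbound : |(∫ y, g y) - ∫ y : ℝ, Real.exp (-(N * s / 2) * y ^ 2)| ≤
      K / N * (√(Real.pi / (s / 8)) * N ^ (-(1 / 2) : ℝ)) := by
    rw [← integral_sub hgi hGi, ← integral_gaussian_mul_nat (by positivity) hN0,
      ← integral_const_mul, ← Real.norm_eq_abs]
    exact norm_integral_le_of_norm_le
      ((integrable_exp_neg_mul_sq (by positivity)).const_mul _) (.of_forall hpt)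
  have hsq : √(N / (2 * Real.pi * s)) =
      N / (2 * Real.pi) * ∫ y : ℝ, Real.exp (-(N * s / 2) * y ^ 2) := by
    rw [integral_gaussian]
    have : N / (2 * Real.pi) = √((N / (2 * Real.pi)) ^ 2) := (Real.sqrt_sq (by positivity)).symm
    rw [this, ← Real.sqrt_mul (by positivity)]
    congr 1
    have := Real.pi_pos
    field_simp
  have hmul : ((N : ℂ) / (2 * Real.pi) * ∫ y in Set.Icc (-δ) δ, f y).re =
      N / (2 * Real.pi) * ∫ y, g y := by
    rw [hgint, ← Complex.re_ofReal_mul]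
    push_cast; rfl
  rw [hmul, hsq, ← mul_sub, abs_mul, abs_of_pos (by positivity)]
  calc _ ≤ N / (2 * Real.pi) * (K / N * (√(Real.pi / (s / 8)) * N ^ (-(1 / 2) : ℝ))) := by gcongr
    _ = _ := by field_simp

/-! ### Non-stationary phase away from the mean -/

lemma exists_norm_le_of_continuousOn_Icc {g : ℝ → ℂ} {δ : ℝ}
    (hg : ContinuousOn g (Set.Icc (-δ) δ)) :
    ∃ M : ℝ, 0 ≤ M ∧ ∀ y ∈ Set.Icc (-δ) δ, ‖g y‖ ≤ M := by
  obtain ⟨M, hM⟩ := isCompact_Icc.exists_bound_of_continuousOn hg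
  exact ⟨max M 0, le_max_right _ _, fun y hy => (hM y hy).trans (le_max_left _ _)⟩

/-- Off the saddle point, one integration by parts bounds the local inversion integral. -/
lemma exists_norm_integral_le {F : ℂ → ℂ} {s ε δ : ℝ} (hs : 0 < s) (hδ : 0 < δ)
    (hF : ∀ y : ℝ, |y| ≤ δ → AnalyticAt ℂ F (y * Complex.I))
    (hne : ∀ y : ℝ, |y| ≤ δ → deriv F (y * Complex.I) ≠ ε)
    (h : ∀ y : ℝ, |y| ≤ δ → (F (y * Complex.I)).re ≤ -(s / 4 * y ^ 2)) :
    ∃ D : ℝ, ∀ N : ℝ, 1 ≤ N →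
      ‖N / (2 * Real.pi) * ∫ y in Set.Icc (-δ) δ,
          Complex.exp (N * F (y * Complex.I)) * Complex.exp (-(N * ε * y * Complex.I))‖ ≤
        D * N ^ (-(1 / 2) : ℝ) := by
  -- The integrand `v` satisfies `v' = N * p * v` with `p` nowhere zero, so `v = v' / (N * p)` can
  -- be integrated by parts.
  set p : ℝ → ℂ := fun y => (deriv F (y * Complex.I) - ε) * Complex.I with hp
  set p' : ℝ → ℂ := fun y => deriv (deriv F) (y * Complex.I) * Complex.I * Complex.I with hp'
  have hline : ∀ y : ℝ, HasDerivAt (fun y : ℝ => (y : ℂ) * Complex.I) Complex.I y := fun y => by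
    simpa using (hasDerivAt_id (y : ℂ)).comp_ofReal.mul_const Complex.I
  have hpd : ∀ y : ℝ, |y| ≤ δ → HasDerivAt p (p' y) y := fun y hy =>
    (((hF y hy).deriv.differentiableAt.hasDerivAt.comp y (hline y)).sub_const _).mul_const _
  have hp'c : ContinuousOn p' (Set.Icc (-δ) δ) := fun y hy => by
    have h1 := ((hF y (abs_le.2 hy)).deriv.deriv.continuousAt)
    have h2 : ContinuousAt (fun y : ℝ => (y : ℂ) * Complex.I) y := (hline y).continuousAt
    have h3 : ContinuousAt (fun y : ℝ => deriv (deriv F) (y * Complex.I)) y :=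
      ContinuousAt.comp (f := fun y : ℝ => (y : ℂ) * Complex.I) h1 h2
    exact ((h3.mul continuousAt_const).mul continuousAt_const).continuousWithinAt
  have hpc : ContinuousOn p (Set.Icc (-δ) δ) := fun y hy =>
    (hpd y (abs_le.2 hy)).continuousAt.continuousWithinAt
  have hp0 : ∀ y : ℝ, |y| ≤ δ → p y ≠ 0 := fun y hy =>
    mul_ne_zero (sub_ne_zero.2 (hne y hy)) Complex.I_ne_zero
  have hinvc : ContinuousOn (fun y => (p y)⁻¹) (Set.Icc (-δ) δ) :=
    hpc.inv₀ fun y hy => hp0 y (abs_le.2 hy)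
  have hinv'c : ContinuousOn (fun y => -p' y / p y ^ 2) (Set.Icc (-δ) δ) :=
    hp'c.neg.div (hpc.pow 2) fun y hy => pow_ne_zero 2 (hp0 y (abs_le.2 hy))
  obtain ⟨M₁, hM₁, hb₁⟩ := exists_norm_le_of_continuousOn_Icc hinvc
  obtain ⟨M₂, hM₂, hb₂⟩ := exists_norm_le_of_continuousOn_Icc hinv'c
  refine ⟨1 / (2 * Real.pi) * (2 * (M₁ * (4 / (s * δ ^ 2))) + M₂ * √(Real.pi / (s / 4))),
    fun N hN => ?_⟩
  have hN0 : 0 < N := by linarith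
  set v : ℝ → ℂ := fun y =>
    Complex.exp (N * F (y * Complex.I)) * Complex.exp (-(N * ε * y * Complex.I)) with hv
  have hvn : ∀ y : ℝ, |y| ≤ δ → ‖v y‖ ≤ Real.exp (-(N * (s / 4)) * y ^ 2) := fun y hy => by
    rw [hv]
    simp only []
    rw [← Complex.exp_add, Complex.norm_exp]
    apply Real.exp_le_exp.2
    have : (N * F (y * Complex.I) + -(N * ε * y * Complex.I)).re = N * (F (y * Complex.I)).re := by
      simp
    rw [this]
    calc _ ≤ N * (-(s / 4 * y ^ 2)) := by gcongr; exact h y hy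
      _ = _ := by ring
  have hvd : ∀ y : ℝ, |y| ≤ δ → HasDerivAt v (N * p y * v y) y := fun y hy => by
    have h1 := (((hF y hy).differentiableAt.hasDerivAt.comp y (hline y)).const_mul (N : ℂ)).cexp
    have h2 : HasDerivAt (fun y : ℝ => -((N : ℂ) * ε * y * Complex.I)) (-(N * ε * Complex.I)) y := by
      have := ((hline y).const_mul ((N : ℂ) * ε)).neg
      refine this.congr_of_eventuallyEq (.of_forall fun z => ?_)
      simp [mul_assoc]
    refine (h1.mul h2.cexp).congr_deriv ?_
    simp only [hp, hv, Function.comp_apply]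
    ring
  have hvc : ContinuousOn v (Set.Icc (-δ) δ) := fun y hy =>
    (hvd y (abs_le.2 hy)).continuousAt.continuousWithinAt
  have hle : -δ ≤ δ := by linarith
  have huI : Set.uIcc (-δ) δ = Set.Icc (-δ) δ := Set.uIcc_of_le hle
  have hparts := intervalIntegral.integral_mul_deriv_eq_deriv_mul (a := -δ) (b := δ)
    (u := fun y => (p y)⁻¹) (v := v) (u' := fun y => -p' y / p y ^ 2)
    (v' := fun y => N * p y * v y)
    (fun y hy => (hpd y (abs_le.2 (Set.mem_Icc.1 (huI ▸ hy)))).inv (hp0 y (abs_le.2 (Set.mem_Icc.1 (huI ▸ hy)))))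
    (fun y hy => hvd y (abs_le.2 (Set.mem_Icc.1 (huI ▸ hy))))
    (ContinuousOn.intervalIntegrable (huI ▸ hinv'c))
    (ContinuousOn.intervalIntegrable (huI ▸ ((continuousOn_const.mul hpc).mul hvc)))
  have hlhs : ∫ y in (-δ)..δ, (p y)⁻¹ * (N * p y * v y) = N * ∫ y in Set.Icc (-δ) δ, v y := by
    rw [integral_Icc_eq_integral_Ioc, ← intervalIntegral.integral_of_le hle,
      ← intervalIntegral.integral_const_mul]
    refine intervalIntegral.integral_congr fun y hy => ?_
    have := hp0 y (abs_le.2 (Set.mem_Icc.1 (huI ▸ hy)))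
    field_simp
  -- The boundary terms decay exponentially, but `u ≤ exp u` is enough. The rate `N^(-1/2)` is
  -- dictated by the Gaussian bound on the remaining integral.
  have hend : ∀ y : ℝ, |y| = δ → ‖(p y)⁻¹ * v y‖ ≤ M₁ * (4 / (s * δ ^ 2)) * N ^ (-(1 / 2) : ℝ) := by
    intro y hy
    rw [norm_mul, mul_assoc]
    refine mul_le_mul (hb₁ y (abs_le.1 hy.le)) ((hvn y hy.le).trans ?_) (norm_nonneg _) hM₁
    have hyy : y ^ 2 = δ ^ 2 := by rw [← hy, sq_abs]
    rw [hyy, neg_mul, Real.exp_neg]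
    have h1 : N * (s / 4) * δ ^ 2 ≤ Real.exp (N * (s / 4) * δ ^ 2) := by
      have := Real.add_one_le_exp (N * (s / 4) * δ ^ 2); linarith
    calc _ ≤ (N * (s / 4) * δ ^ 2)⁻¹ := inv_anti₀ (by positivity) h1
      _ = 4 / (s * δ ^ 2) * N ^ (-1 : ℝ) := by rw [Real.rpow_neg_one]; field_simp
      _ ≤ _ := by
        gcongr
        norm_num
  have hmid : ‖∫ y in (-δ)..δ, -p' y / p y ^ 2 * v y‖ ≤
      M₂ * √(Real.pi / (s / 4)) * N ^ (-(1 / 2) : ℝ) := by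
    rw [intervalIntegral.integral_of_le hle, mul_assoc,
      ← integral_gaussian_mul_nat (by positivity) hN0, ← integral_const_mul]
    have hGi : Integrable fun y : ℝ => M₂ * Real.exp (-(N * (s / 4)) * y ^ 2) :=
      (integrable_exp_neg_mul_sq (by positivity)).const_mul _
    refine le_trans (norm_integral_le_of_norm_le hGi.integrableOn
      ((ae_restrict_iff' measurableSet_Ioc).2 (.of_forall fun y hy => ?_)))
      (setIntegral_le_integral hGi (.of_forall fun y => by positivity))
    have hy' := Set.Ioc_subset_Icc_self hy
    rw [norm_mul]
    exact mul_le_mul (hb₂ y hy') (hvn y (abs_le.2 hy')) (norm_nonneg _) hM₂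
  have hfin : ‖(N : ℂ) * ∫ y in Set.Icc (-δ) δ, v y‖ ≤
      (2 * (M₁ * (4 / (s * δ ^ 2))) + M₂ * √(Real.pi / (s / 4))) * N ^ (-(1 / 2) : ℝ) := by
    rw [← hlhs, hparts]
    have h1 := hend δ (abs_of_pos hδ)
    have h2 := hend (-δ) (by rw [abs_neg, abs_of_pos hδ])
    calc _ ≤ ‖(p δ)⁻¹ * v δ‖ + ‖(p (-δ))⁻¹ * v (-δ)‖ +
          ‖∫ y in (-δ)..δ, -p' y / p y ^ 2 * v y‖ :=
        (norm_sub_le _ _).trans (by gcongr; exact norm_sub_le _ _)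
      _ ≤ _ := by linarith
  have hsplit : (N : ℂ) / (2 * Real.pi) * ∫ y in Set.Icc (-δ) δ, v y =
      ((1 / (2 * Real.pi) : ℝ) : ℂ) * (N * ∫ y in Set.Icc (-δ) δ, v y) := by
    push_cast; ring
  rw [hsplit, norm_mul, Complex.norm_real, Real.norm_of_nonneg (by positivity), mul_assoc]
  gcongr

/-! ### Analytic continuation and the laws with density `w` -/

/-- Identity theorem for functions that agree on the real line near the origin. -/
lemma eqOn_of_eventually_eq_ofReal {f g : ℂ → ℂ} {U : Set ℂ} (hf : AnalyticOnNhd ℂ f U)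
    (hg : AnalyticOnNhd ℂ g U) (hU : IsPreconnected U) (h0 : (0 : ℂ) ∈ U)
    (h : ∀ᶠ t : ℝ in 𝓝 0, f t = g t) : Set.EqOn f g U := by
  refine hf.eqOn_of_preconnected_of_frequently_eq hg hU h0 ?_
  have h_real : ∃ᶠ t : ℝ in 𝓝[≠] 0, f t = g t :=
    (h.filter_mono nhdsWithin_le_nhds).frequently
  have htend : Tendsto (fun t : ℝ => (t : ℂ)) (𝓝[≠] 0) (𝓝[≠] 0) := by
    refine tendsto_nhdsWithin_iff.2 ⟨?_, ?_⟩
    · simpa using (Complex.continuous_ofReal.tendsto 0).mono_left nhdsWithin_le_nhds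
    · filter_upwards [self_mem_nhdsWithin] with t ht
      simpa using ht
  exact htend.frequently h_real

lemma analyticAt_of_analyticOnNhd_comp_neg {F : ℂ → ℂ} {U : Set ℂ}
    (hF : AnalyticOnNhd ℂ (fun t : ℂ => F (-t)) U) {s : ℂ} (hs : -s ∈ U) : AnalyticAt ℂ F s := by
  have h := (hF (-s) hs).comp_of_eq (f := fun z : ℂ => -z) analyticAt_id.neg rfl
  simpa [Function.comp_def] using h

namespace IsExtensiveWeight

variable {F : ℂ → ℂ} {R : ℝ} {N : ℕ} {w : ℝ → ℝ}

lemma integrable (hR : 0 < R) (h : IsExtensiveWeight F R N w) : Integrable w := by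
  have h1 := h.integrable_exp 0 hR
  simp only [zero_mul, Real.exp_zero] at h1
  rw [weightMeasure, integrable_withDensity_iff (h.continuous.measurable.ennreal_ofReal)
    (.of_forall fun x => ENNReal.ofReal_lt_top)] at h1
  refine h1.congr (.of_forall fun x => ?_)
  simp [ENNReal.toReal_ofReal (h.nonneg x)]

lemma isProbabilityMeasure (hR : 0 < R) (hF0 : F 0 = 0) (h : IsExtensiveWeight F R N w) :
    IsProbabilityMeasure (weightMeasure w) := by
  have h1 := h.mgf_eq 0 hR
  simp only [mgf_zero', Complex.ofReal_zero, hF0, mul_zero, Complex.exp_zero] at h1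
  have h2 : (weightMeasure w).real Set.univ = 1 := by exact_mod_cast h1
  refine ⟨?_⟩
  rw [measureReal_def] at h2
  exact (ENNReal.toReal_eq_one_iff _).1 h2

lemma integral_eq_one (hR : 0 < R) (hF0 : F 0 = 0) (h : IsExtensiveWeight F R N w) :
    ∫ x, w x = 1 := by
  have := h.isProbabilityMeasure hR hF0
  have h1 := integral_weightMeasure h.nonneg h.continuous fun _ => 1
  simp only [integral_const, probReal_univ, one_smul, one_mul] at h1
  rw [integral_complex_ofReal] at h1
  exact_mod_cast h1.symm

lemma mem_interior_integrableExpSet (h : IsExtensiveWeight F R N w) {t : ℝ} (ht : t < R) :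
    t ∈ interior (integrableExpSet (fun ε : ℝ => (N : ℝ) * ε) (weightMeasure w)) :=
  mem_interior.2 ⟨Set.Iio R, fun t ht => h.integrable_exp t ht, isOpen_Iio, ht⟩

lemma analyticOnNhd_complexMGF (h : IsExtensiveWeight F R N w) :
    AnalyticOnNhd ℂ (complexMGF (fun ε : ℝ => (N : ℝ) * ε) (weightMeasure w)) {z | z.re < R} :=
  fun _ hz => analyticAt_complexMGF (h.mem_interior_integrableExpSet hz)

/-- As `exp (N F t)` is real, `Im F t` lies in the discrete group generated by `π / N`. It is
continuous on a connected half-line and zero at the origin, hence zero. -/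
lemma im_eq_zero (hR : 0 < R) (hF0 : F 0 = 0) (hN : 0 < N)
    (hF : ∀ t : ℝ, t < R → AnalyticAt ℂ F t)
    (h : IsExtensiveWeight F R N w) {t : ℝ} (ht : t < R) : (F t).im = 0 := by
  have hN' : (N : ℝ) ≠ 0 := by exact_mod_cast hN.ne'
  have hc : ContinuousOn (fun t : ℝ => (F t).im) (Set.Iio R) := fun t ht =>
    (Complex.continuous_im.continuousAt.comp
      ((hF t ht).continuousAt.comp Complex.continuous_ofReal.continuousAt)).continuousWithinAt
  have hmaps : Set.MapsTo (fun t : ℝ => (F t).im) (Set.Iio R)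
      (AddSubgroup.zmultiples (Real.pi / N) : Set ℝ) := by
    intro t ht
    have h1 := congrArg Complex.im (h.mgf_eq t ht)
    rw [Complex.ofReal_im, Complex.exp_im] at h1
    have h2 : Real.sin ((N : ℂ) * F t).im = 0 := by
      rcases mul_eq_zero.1 h1.symm with h | h
      · exact absurd h (Real.exp_pos _).ne'
      · exact h
    obtain ⟨n, hn⟩ := Real.sin_eq_zero_iff.1 h2
    refine AddSubgroup.mem_zmultiples_iff.2 ⟨n, ?_⟩
    simp at hn
    simp only [zsmul_eq_mul]
    field_simp
    linarith
  have := isPreconnected_Iio.constant_of_mapsTo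
    (isDiscrete_iff_discreteTopology.2 (inferInstanceAs
      (DiscreteTopology (AddSubgroup.zmultiples (Real.pi / N))))) hc hmaps ht (Set.mem_Iio.2 hR)
  simpa [hF0] using this

lemma cgf_eq (h : IsExtensiveWeight F R N w) {t : ℝ} (ht : t < R) :
    cgf (fun ε : ℝ => (N : ℝ) * ε) (weightMeasure w) t = N * (F t).re := by
  have h1 := congrArg norm (h.mgf_eq t ht)
  rw [Complex.norm_real, Complex.norm_exp, Real.norm_of_nonneg mgf_nonneg] at h1
  rw [cgf, h1, Real.log_exp]
  simp

lemma iteratedDeriv_two_cgf_eq (hF : ∀ t : ℝ, t < R → AnalyticAt ℂ F t)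
    (h : IsExtensiveWeight F R N w) {t : ℝ} (ht : t < R) :
    iteratedDeriv 2 (cgf (fun ε : ℝ => (N : ℝ) * ε) (weightMeasure w)) t =
      N * (iteratedDeriv 2 F t).re := by
  have h1 : ∀ x : ℝ, x < R → deriv (cgf (fun ε : ℝ => (N : ℝ) * ε) (weightMeasure w)) x =
      N * (deriv F x).re := fun x hx => by
    have e : cgf (fun ε : ℝ => (N : ℝ) * ε) (weightMeasure w) =ᶠ[𝓝 x] fun t => N * (F t).re := by
      filter_upwards [Iio_mem_nhds hx] with y hy using h.cgf_eq hy
    rw [e.deriv_eq]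
    exact ((hF x hx).differentiableAt.hasDerivAt.real_of_complex.const_mul (N : ℝ)).deriv
  have e : deriv (cgf (fun ε : ℝ => (N : ℝ) * ε) (weightMeasure w)) =ᶠ[𝓝 t]
      fun t => N * (deriv F t).re := by
    filter_upwards [Iio_mem_nhds ht] with y hy using h1 y hy
  rw [iteratedDeriv_succ, iteratedDeriv_one, e.deriv_eq, iteratedDeriv_succ, iteratedDeriv_one]
  exact ((hF t ht).deriv.differentiableAt.hasDerivAt.real_of_complex.const_mul (N : ℝ)).deriv

/-- `N F''(t)` is the variance of `N ε` under the law tilted by `t`. Were it zero, the law would sit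
at a single point, which absolute continuity forbids. -/
lemma iteratedDeriv_two_re_pos (hR : 0 < R) (hF0 : F 0 = 0) (hN : 0 < N)
    (hF : ∀ t : ℝ, t < R → AnalyticAt ℂ F t)
    (h : IsExtensiveWeight F R N w) {t : ℝ} (ht : t < R) : 0 < (iteratedDeriv 2 F t).re := by
  have hprob := h.isProbabilityMeasure hR hF0
  have hN' : (0 : ℝ) < N := by exact_mod_cast hN
  have hmem := h.mem_interior_integrableExpSet ht
  have hvar := variance_tilted_mul hmem
  have hint := h.integrable_exp t ht
  have := isProbabilityMeasure_tilted hint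
  rw [h.iteratedDeriv_two_cgf_eq hF ht] at hvar
  have hnonneg := variance_nonneg (fun ε : ℝ => (N : ℝ) * ε)
    ((weightMeasure w).tilted fun ε => t * ((N : ℝ) * ε))
  rw [hvar] at hnonneg
  refine lt_of_le_of_ne (nonneg_of_mul_nonneg_right hnonneg hN') fun hzero => ?_
  rw [← hzero, mul_zero] at hvar
  have hae := ae_eq_integral_of_variance_eq_zero (memLp_tilted_mul hmem 2) hvar
  have hac : (weightMeasure w).tilted (fun ε => t * ((N : ℝ) * ε)) ≪ volume :=
    (tilted_absolutelyContinuous _ _).trans (withDensity_absolutelyContinuous _ _)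
  set c := ∫ ε, (N : ℝ) * ε ∂((weightMeasure w).tilted fun ε => t * ((N : ℝ) * ε))
  have hnull : ∀ᵐ ε ∂((weightMeasure w).tilted fun ε => t * ((N : ℝ) * ε)), ε ≠ c / N :=
    
    hac.ae_le ((Set.countable_singleton (c / N)).ae_notMem volume)
  have hfalse : ∀ᵐ _ε ∂((weightMeasure w).tilted fun ε => t * ((N : ℝ) * ε)), False := by
    filter_upwards [hae, hnull] with ε h1 h2
    exact h2 (by rw [← h1]; field_simp)
  simp at hfalse
  exact IsProbabilityMeasure.ne_zero _ hfalse

/-- Both sides are `exp (N K F t)` at real `t`, and both are analytic on the whole half-plane. This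
reaches heights on the imaginary axis where `F` itself is not assumed analytic. -/
lemma complexMGF_pow_eq (hR : 0 < R) {K : ℕ} {v : ℝ → ℝ} (h : IsExtensiveWeight F R N w)
    (h' : IsExtensiveWeight F R K v) {z : ℂ} (hz : z.re < R) :
    complexMGF (fun ε : ℝ => (N : ℝ) * ε) (weightMeasure w) z ^ K =
      complexMGF (fun ε : ℝ => (K : ℝ) * ε) (weightMeasure v) z ^ N := by
  refine eqOn_of_eventually_eq_ofReal (h.analyticOnNhd_complexMGF.pow K)
    (h'.analyticOnNhd_complexMGF.pow N)
    ((convex_Iio R).linear_preimage Complex.reLm).isPreconnected (by simpa) ?_ hz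
  filter_upwards [Iio_mem_nhds hR] with t ht
  simp only [Pi.pow_apply]
  rw [complexMGF_ofReal, complexMGF_ofReal, h.mgf_eq t ht, h'.mgf_eq t ht, ← Complex.exp_nat_mul,
    ← Complex.exp_nat_mul]
  ring_nf

lemma complexMGF_eq_exp (hR : 0 < R) (hF : ∀ z : ℂ, ‖z‖ < R → AnalyticAt ℂ F z)
    (h : IsExtensiveWeight F R N w) {z : ℂ} (hz : ‖z‖ < R) :
    complexMGF (fun ε : ℝ => (N : ℝ) * ε) (weightMeasure w) z = Complex.exp (N * F z) := by
  have hF' : AnalyticOnNhd ℂ F (Metric.ball 0 R) := fun z hz => hF z (by simpa using hz)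
  refine eqOn_of_eventually_eq_ofReal (U := Metric.ball 0 R)
    (h.analyticOnNhd_complexMGF.mono fun z hz => ?_) (analyticOnNhd_const.mul hF').cexp
    (convex_ball 0 R).isPreconnected (by simpa) ?_ (by simpa using hz)
  · exact (Complex.re_le_norm z).trans_lt (by simpa using hz)
  · filter_upwards [Iio_mem_nhds hR] with t ht
    rw [complexMGF_ofReal, h.mgf_eq t ht]

lemma continuous_complexMGF_mul_I (hR : 0 < R) (h : IsExtensiveWeight F R N w) :
    Continuous fun y : ℝ =>
      complexMGF (fun ε : ℝ => (N : ℝ) * ε) (weightMeasure w) (y * Complex.I) :=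
  continuous_iff_continuousAt.2 fun y => by
    have h1 := (h.analyticOnNhd_complexMGF (y * Complex.I) (by simpa)).continuousAt
    have h2 : ContinuousAt (fun y : ℝ => (y : ℂ) * Complex.I) y := by fun_prop
    exact ContinuousAt.comp (f := fun y : ℝ => (y : ℂ) * Complex.I) h1 h2

lemma norm_complexMGF_mul_I_lt (hR : 0 < R) (hF0 : F 0 = 0) (hN : 0 < N)
    (h : IsExtensiveWeight F R N w) {y : ℝ} (hy : y ≠ 0) :
    ‖complexMGF (fun ε : ℝ => (N : ℝ) * ε) (weightMeasure w) (y * Complex.I)‖ < 1 := by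
  have hN' : (0 : ℝ) < N := by exact_mod_cast hN
  rw [complexMGF_weightMeasure_mul_I h.nonneg h.continuous, ← h.integral_eq_one hR hF0]
  exact norm_fourier_lt_integral h.nonneg (h.integrable hR)
    (by rw [h.integral_eq_one hR hF0]; exact one_pos)
    (mul_ne_zero (neg_ne_zero.2 (by positivity)) hy)

lemma norm_complexMGF_mul_I_le (hR : 0 < R) (hF0 : F 0 = 0)
    (h : IsExtensiveWeight F R N w) (y : ℝ) :
    ‖complexMGF (fun ε : ℝ => (N : ℝ) * ε) (weightMeasure w) (y * Complex.I)‖ ≤ 1 := by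
  have := h.isProbabilityMeasure hR hF0
  refine norm_complexMGF_le_mgf.trans_eq ?_
  simp

lemma tendsto_complexMGF_mul_I (hN : 0 < N) (h : IsExtensiveWeight F R N w) :
    Tendsto (fun y : ℝ => complexMGF (fun ε : ℝ => (N : ℝ) * ε) (weightMeasure w) (y * Complex.I))
      (cocompact ℝ) (𝓝 0) := by
  have hN' : (0 : ℝ) < N := by exact_mod_cast hN
  simp_rw [complexMGF_weightMeasure_mul_I h.nonneg h.continuous]
  have hne : -((N : ℝ) / (2 * Real.pi)) ≠ 0 := neg_ne_zero.2 (by positivity)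
  exact (Real.zero_at_infty_fourier _).comp
    (Homeomorph.mulLeft₀ _ hne).isClosedEmbedding.tendsto_cocompact

lemma integrable_norm_sq_complexMGF_mul_I (hR : 0 < R) (hN : 0 < N)
    (h : IsExtensiveWeight F R N w) :
    Integrable fun y : ℝ =>
      ‖complexMGF (fun ε : ℝ => (N : ℝ) * ε) (weightMeasure w) (y * Complex.I)‖ ^ 2 := by
  have hN' : (0 : ℝ) < N := by exact_mod_cast hN
  obtain ⟨B, hB⟩ := h.bddAbove
  simp_rw [complexMGF_weightMeasure_mul_I h.nonneg h.continuous]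
  exact (integrable_norm_sq_fourier h.nonneg (h.integrable hR)
    fun x => hB (Set.mem_range_self x)).comp_mul_left' (neg_ne_zero.2 (by positivity))

end IsExtensiveWeight

/-! ### Negligible terms, convexity and reduction to the local integral -/

/-- `N q ^ N` is negligible compared with `N ^ (-1/2)`. -/
lemma isBigO_nat_mul_pow {q : ℝ} (hq0 : 0 ≤ q) (hq1 : q < 1) :
    (fun N : ℕ => (N : ℝ) * q ^ N) =O[atTop] (fun N : ℕ => (N : ℝ) ^ (-(1 / 2) : ℝ)) := by
  have h := tendsto_pow_const_mul_const_pow_of_abs_lt_one 2 (by rwa [abs_of_nonneg hq0] : |q| < 1)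
  refine IsBigO.of_bound 1 ?_
  filter_upwards [h.eventually_le_const one_pos, eventually_ge_atTop 1] with N hN hN1
  have hN' : (1 : ℝ) ≤ N := by exact_mod_cast hN1
  have hN0 : (0 : ℝ) < N := by linarith
  rw [Real.norm_of_nonneg (by positivity), Real.norm_of_nonneg (by positivity), one_mul]
  calc (N : ℝ) * q ^ N = (N : ℝ) ^ 2 * q ^ N * (N : ℝ) ^ (-1 : ℝ) := by
        rw [Real.rpow_neg_one]; field_simp
    _ ≤ 1 * (N : ℝ) ^ (-(1 / 2) : ℝ) := by
        gcongr
        norm_num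
    _ = _ := one_mul _

/-- Away from the mean the saddle point term is exponentially small. -/
lemma isBigO_sqrt_mul_exp {s a : ℝ} (hs : 0 < s) (ha : a < 0) :
    (fun N : ℕ => √((N : ℝ) / (2 * Real.pi * s)) * Real.exp ((N : ℝ) * a)) =O[atTop]
      (fun N : ℕ => (N : ℝ) ^ (-(1 / 2) : ℝ)) := by
  refine IsBigO.trans (IsBigO.of_bound (√(1 / (2 * Real.pi * s))) ?_)
    (isBigO_nat_mul_pow (Real.exp_pos a).le (by simpa using ha))
  filter_upwards [eventually_ge_atTop 1] with N hN1
  have hN' : (1 : ℝ) ≤ N := by exact_mod_cast hN1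
  have hsq : √((N : ℝ) / (2 * Real.pi * s)) ≤ √(1 / (2 * Real.pi * s)) * N := by
    rw [div_eq_mul_one_div, Real.sqrt_mul (by positivity), mul_comm]
    gcongr
    exact Real.sqrt_le_iff.2 ⟨by linarith, by nlinarith⟩
  rw [Real.norm_of_nonneg (by positivity), Real.norm_of_nonneg (by positivity),
    ← Real.exp_nat_mul, ← mul_assoc]
  gcongr

/-- The derivative of a convex cumulant generating function is strictly increasing. -/
lemma strictMonoOn_re_deriv {F : ℂ → ℂ} {R : ℝ} (hF : ∀ t : ℝ, t < R → AnalyticAt ℂ F t)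
    (hpos : ∀ t : ℝ, t < R → 0 < (iteratedDeriv 2 F t).re) :
    StrictMonoOn (fun t : ℝ => (deriv F t).re) (Set.Iio R) := by
  have hd : ∀ t : ℝ, t < R →
      HasDerivAt (fun t : ℝ => (deriv F t).re) (iteratedDeriv 2 F t).re t := fun t ht => by
    rw [iteratedDeriv_succ, iteratedDeriv_one]
    exact (hF t ht).deriv.differentiableAt.hasDerivAt.real_of_complex
  refine strictMonoOn_of_deriv_pos (convex_Iio R)
    (fun t ht => (hd t ht).continuousAt.continuousWithinAt) fun t ht => ?_
  rw [interior_Iio] at ht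
  rw [(hd t ht).deriv]
  exact hpos t ht

/-- The entropy is negative away from the mean. -/
lemma neg_mul_add_re_neg {F : ℂ → ℂ} {R : ℝ} (hR : 0 < R) (hF0 : F 0 = 0)
    (hF : ∀ t : ℝ, t < R → AnalyticAt ℂ F t)
    (hmono : StrictMonoOn (fun t : ℝ => (deriv F t).re) (Set.Iio R)) {x : ℝ} (hx : x < R)
    (hx0 : x ≠ 0) : -(deriv F x).re * x + (F x).re < 0 := by
  have hd : ∀ t : ℝ, t < R → HasDerivAt (fun t : ℝ => (F t).re) (deriv F t).re t := fun t ht =>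
    (hF t ht).differentiableAt.hasDerivAt.real_of_complex
  have hF0' : (F ((0 : ℝ) : ℂ)).re = 0 := by simp [hF0]
  -- The mean value theorem gives `F x = x F'(c)` with `c` strictly between `0` and `x`. The
  -- expression is then `x (F'(c) - F'(x))`, negative on either side by monotonicity.
  rcases lt_or_gt_of_ne hx0 with h | h
  · obtain ⟨c, hc, hc'⟩ := exists_hasDerivAt_eq_slope (fun t : ℝ => (F t).re)
      (fun t => (deriv F t).re) h
      (fun t ht => (hd t (ht.2.trans_lt hR)).continuousAt.continuousWithinAt)
      (fun t ht => hd t (ht.2.trans hR))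
    have hlt : (deriv F x).re < (deriv F c).re := hmono hx (hc.2.trans hR) hc.1
    rw [eq_div_iff (by linarith), hF0'] at hc'
    nlinarith
  · obtain ⟨c, hc, hc'⟩ := exists_hasDerivAt_eq_slope (fun t : ℝ => (F t).re)
      (fun t => (deriv F t).re) h
      (fun t ht => (hd t (ht.2.trans_lt hx)).continuousAt.continuousWithinAt)
      (fun t ht => hd t (ht.2.trans hx))
    have hlt : (deriv F c).re < (deriv F x).re := hmono (hc.2.trans hx) hx hc.2
    rw [eq_div_iff (by linarith), hF0'] at hc'
    nlinarith

/-- The weights are given by the local inversion integral up to an exponentially small error. -/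
lemma isBigO_sub_re_integral {F : ℂ → ℂ} {R : ℝ} (hR : 0 < R) (hF0 : F 0 = 0)
    (hF : ∀ z : ℂ, ‖z‖ < R → AnalyticAt ℂ F z) {w : ℕ → ℝ → ℝ}
    (hw : ∀ᶠ N : ℕ in atTop, IsExtensiveWeight F R N (w N)) {δ : ℝ} (hδ : 0 < δ) (hδR : δ < R)
    (ε : ℝ) :
    (fun N : ℕ => w N ε - ((N : ℂ) / (2 * Real.pi) * ∫ y in Set.Icc (-δ) δ,
        Complex.exp (N * F (y * Complex.I)) * Complex.exp (-(N * ε * y * Complex.I))).re)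
      =O[atTop] (fun N : ℕ => (N : ℝ) ^ (-(1 / 2) : ℝ)) := by
  -- `K` is the fixed reference size whose characteristic function controls all later ones.
  obtain ⟨K, hK1, hK⟩ : ∃ K : ℕ, 0 < K ∧ ∀ N, K ≤ N → IsExtensiveWeight F R N (w N) := by
    obtain ⟨K, hK⟩ := eventually_atTop.1 hw
    exact ⟨max K 1, by positivity, fun N hN => hK N ((le_max_left _ _).trans hN)⟩
  set φ : ℕ → ℝ → ℂ := fun N y =>
    complexMGF (fun ε : ℝ => (N : ℝ) * ε) (weightMeasure (w N)) (y * Complex.I) with hφ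
  have hKK := hK K le_rfl
  obtain ⟨q, C, hq0, hq1, htail⟩ := exists_tail_bound (φ := φ) hK1.ne'
    (fun N hN => (hK N hN).continuous_complexMGF_mul_I hR)
    (fun N hN y => (hK N hN).complexMGF_pow_eq hR hKK (by simpa))
    (fun y => hKK.norm_complexMGF_mul_I_le hR hF0 y)
    (fun y hy => hKK.norm_complexMGF_mul_I_lt hR hF0 hK1 hy)
    (hKK.tendsto_complexMGF_mul_I hK1) (hKK.integrable_norm_sq_complexMGF_mul_I hR hK1) hδ
  refine IsBigO.trans (IsBigO.of_bound (C / (2 * Real.pi)) ?_) (isBigO_nat_mul_pow hq0.le hq1)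
  filter_upwards [eventually_ge_atTop (2 * K)] with N hN
  have hNpos : (0 : ℝ) < N := by exact_mod_cast (by omega : 0 < N)
  have hwN := hK N (by omega)
  obtain ⟨hint, hb⟩ := htail N hN
  set e : ℝ → ℂ := fun y => Complex.exp (-(N * ε * y * Complex.I)) with he
  have hen : ∀ y, ‖e y‖ = 1 := fun y => by
    rw [he]; simp [Complex.norm_exp]
  have hinte : Integrable fun y => φ N y * e y := by
    refine hint.mul_bdd (c := 1) (Continuous.aestronglyMeasurable (by fun_prop))
      (.of_forall fun y => (hen y).le)
  have hinv := eq_integral_complexMGF hwN.nonneg hwN.continuous (hwN.integrable hR) hNpos hint ε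
  have hlocal : ∫ y in Set.Icc (-δ) δ, φ N y * e y = ∫ y in Set.Icc (-δ) δ,
      Complex.exp (N * F (y * Complex.I)) * Complex.exp (-(N * ε * y * Complex.I)) := by
    refine setIntegral_congr_fun measurableSet_Icc fun y hy => ?_
    have hy' : ‖(y : ℂ) * Complex.I‖ < R := by
      simpa using (abs_le.2 hy).trans_lt hδR
    simp only [hφ, he]
    rw [hwN.complexMGF_eq_exp hR hF hy']
  have hsplit := integral_add_compl (μ := volume) (measurableSet_Icc (a := -δ) (b := δ)) hinte
  have hdiff : (w N ε : ℂ) - (N : ℂ) / (2 * Real.pi) * ∫ y in Set.Icc (-δ) δ, φ N y * e y =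
      (N : ℂ) / (2 * Real.pi) * ∫ y in (Set.Icc (-δ) δ)ᶜ, φ N y * e y := by
    have hinv' : (w N ε : ℂ) = (N : ℂ) / (2 * Real.pi) * ∫ y, φ N y * e y := by
      simpa using hinv
    rw [hinv', ← hsplit]; ring
  have hnb : ‖∫ y in (Set.Icc (-δ) δ)ᶜ, φ N y * e y‖ ≤ C * q ^ N := by
    refine (norm_integral_le_integral_norm _).trans (le_trans (le_of_eq ?_) hb)
    congr 1; ext y
    rw [norm_mul, hen, mul_one]
  rw [← hlocal]
  have hre : w N ε - ((N : ℂ) / (2 * Real.pi) * ∫ y in Set.Icc (-δ) δ, φ N y * e y).re =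
      ((N : ℂ) / (2 * Real.pi) * ∫ y in (Set.Icc (-δ) δ)ᶜ, φ N y * e y).re := by
    rw [← hdiff]; simp
  rw [hre, Real.norm_eq_abs]
  refine (Complex.abs_re_le_norm _).trans ?_
  have hnorm : ‖(N : ℂ) / (2 * Real.pi)‖ = N / (2 * Real.pi) := by
    simp [abs_of_pos Real.pi_pos]
  rw [norm_mul, hnorm, Real.norm_of_nonneg (by positivity)]
  calc _ ≤ (N : ℝ) / (2 * Real.pi) * (C * q ^ N) := by gcongr
    _ = _ := by ring

/-! ### The saddle point formula -/

theorem theorem4 (F : ℂ → ℂ) (R : ℝ) (hR : 0 < R)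
    (hF : AnalyticOnNhd ℂ (fun t : ℂ => F (-t)) {t : ℂ | 0 < t.re ∨ ‖t‖ < R})
    (hF0 : F 0 = 0)
    (w : ℕ → ℝ → ℝ)
    (hw : ∀ᶠ N : ℕ in atTop, IsExtensiveWeight F R N (w N)) :
    (∀ ε ∈ saddleEnergies F R, ∃! x : ℝ, x < R ∧ deriv F (x : ℂ) = (ε : ℂ)) ∧
    ∀ ξ : ℝ → ℝ,
      (∀ ε ∈ saddleEnergies F R, ξ ε < R ∧ deriv F (ξ ε : ℂ) = (ε : ℂ)) →
      ∀ ε ∈ saddleEnergies F R,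
        (F (ξ ε : ℂ)).im = 0 ∧
        (iteratedDeriv 2 F (ξ ε : ℂ)).im = 0 ∧
        0 < (iteratedDeriv 2 F (ξ ε : ℂ)).re ∧
        (fun N : ℕ => w N ε -
            Real.sqrt ((N : ℝ) / (2 * Real.pi * (iteratedDeriv 2 F (ξ ε : ℂ)).re)) *
              Real.exp ((N : ℝ) * (-ε * ξ ε + (F (ξ ε : ℂ)).re)))
          =O[atTop] (fun N : ℕ => (N : ℝ) ^ (-(1 / 2) : ℝ)) := by
  have hball : ∀ z : ℂ, ‖z‖ < R → AnalyticAt ℂ F z := fun z hz =>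
    analyticAt_of_analyticOnNhd_comp_neg hF (Or.inr (by simpa))
  have hreal : ∀ t : ℝ, t < R → AnalyticAt ℂ F t := fun t ht => by
    rcases lt_or_ge t 0 with h | h
    · exact analyticAt_of_analyticOnNhd_comp_neg hF (Or.inl (by simpa))
    · exact hball t (by simpa [abs_of_nonneg h])
  -- Reality and convexity concern `F` alone, so a single system size suffices.
  obtain ⟨N₀, hw₀, hN₀⟩ := (hw.and (eventually_gt_atTop 0)).exists
  have him : ∀ t : ℝ, t < R → (F t).im = 0 := fun t ht => hw₀.im_eq_zero hR hF0 hN₀ hreal ht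
  have hpos : ∀ t : ℝ, t < R → 0 < (iteratedDeriv 2 F t).re := fun t ht =>
    hw₀.iteratedDeriv_two_re_pos hR hF0 hN₀ hreal ht
  have hmono := strictMonoOn_re_deriv hreal hpos
  have huniq : ∀ x y : ℝ, x < R → y < R → deriv F x = deriv F y → x = y := fun x y hx hy hxy =>
    hmono.injOn hx hy (congrArg Complex.re hxy)
  refine ⟨fun ε ⟨x, hx, hxε⟩ => ⟨x, ⟨hx, hxε⟩, fun y hy => huniq y x hy.1 hx (hy.2.trans hxε.symm)⟩,
    fun ξ hξ ε hε => ?_⟩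
  obtain ⟨hx, hxε⟩ := hξ ε hε
  set x := ξ ε
  refine ⟨him x hx, ?_, hpos x hx, ?_⟩
  · exact (eventually_im_iteratedDeriv_eq_zero (hreal x hx)
      (by filter_upwards [Iio_mem_nhds hx] with t ht using him t ht) 2).self_of_nhds
  have hF00 : AnalyticAt ℂ F 0 := hball 0 (by simpa)
  have hre0 : ∀ᶠ t : ℝ in 𝓝 0, (F t).im = 0 := by
    filter_upwards [Iio_mem_nhds hR] with t ht using him t ht
  have hs : 0 < (iteratedDeriv 2 F 0).re := by simpa using hpos 0 hR
  obtain ⟨δ₁, C, hδ₁, hC, hb⟩ := exists_gaussian_bound hF00 hF0 hre0 hs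
  have han : ∀ {δ : ℝ}, δ < R → ∀ y : ℝ, |y| ≤ δ → AnalyticAt ℂ F (y * Complex.I) :=
    fun hδ y hy => hball _ (by simpa using hy.trans_lt hδ)
  -- `x = 0` means that `ε` is the mean `F' 0`; the exponential factor is then one. Otherwise the
  -- weight and the saddle term are bounded separately.
  by_cases hx0 : x = 0
  · have hεμ : (deriv F 0).re = ε := by
      rw [hx0] at hxε
      simpa using congrArg Complex.re hxε
    set δ := min δ₁ (R / 2)
    have hδ : 0 < δ := by positivity
    have hδR : δ < R := (min_le_right _ _).trans_lt (by linarith)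
    have hcont : ContinuousOn (fun y : ℝ => F (y * Complex.I)) (Set.Icc (-δ) δ) := fun y hy => by
      have h2 : ContinuousAt (fun y : ℝ => (y : ℂ) * Complex.I) y := by fun_prop
      exact (ContinuousAt.comp (f := fun y : ℝ => (y : ℂ) * Complex.I)
        (han hδR y (abs_le.2 hy)).continuousAt h2).continuousWithinAt
    rw [hεμ] at hb
    obtain ⟨D, hD⟩ := exists_abs_re_integral_sub_sqrt_le hs hδ hC hcont
      fun y hy => hb y (hy.trans (min_le_left _ _))
    refine ((isBigO_sub_re_integral hR hF0 hball hw hδ hδR ε).add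
      (IsBigO.of_bound D ?_ : (fun N : ℕ => ((N : ℂ) / (2 * Real.pi) * ∫ y in Set.Icc (-δ) δ,
        Complex.exp (N * F (y * Complex.I)) * Complex.exp (-(N * ε * y * Complex.I))).re -
          √(N / (2 * Real.pi * (iteratedDeriv 2 F 0).re))) =O[atTop] _)).congr_left fun N => ?_
    · filter_upwards [eventually_ge_atTop 1] with N hN
      rw [Real.norm_of_nonneg (by positivity : (0 : ℝ) ≤ (N : ℝ) ^ (-(1 / 2) : ℝ))]
      exact_mod_cast hD N (by exact_mod_cast hN)
    · simp [hx0, hF0]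
  · have hεμ : deriv F 0 ≠ ε := fun hcon =>
      hx0 (huniq x 0 hx hR (by rw [hxε, Complex.ofReal_zero, hcon]))
    have hne : ∀ᶠ y : ℝ in 𝓝 0, deriv F (y * Complex.I) ≠ ε := by
      have h1 : Tendsto (fun y : ℝ => (y : ℂ) * Complex.I) (𝓝 0) (𝓝 0) := by
        have : Continuous fun y : ℝ => (y : ℂ) * Complex.I := by fun_prop
        simpa using this.tendsto 0
      exact h1.eventually (hF00.deriv.continuousAt.eventually_ne hεμ)
    obtain ⟨δ₂, hδ₂, hne⟩ := Metric.eventually_nhds_iff.1 hne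
    -- The halves give strict inequalities, so the closed interval stays where `F` is analytic and
    -- `F' ≠ ε`.
    set δ := min δ₁ (min (δ₂ / 2) (R / 2))
    have hδ : 0 < δ := by positivity
    have hδR : δ < R := ((min_le_right _ _).trans (min_le_right _ _)).trans_lt (by linarith)
    have hδ2 : δ < δ₂ := ((min_le_right _ _).trans (min_le_left _ _)).trans_lt (by linarith)
    obtain ⟨D, hD⟩ := exists_norm_integral_le hs hδ (han hδR)
      (fun y hy => hne (by simpa using hy.trans_lt hδ2))
      fun y hy => (hb y (hy.trans (min_le_left _ _))).1
    have hentropy : -ε * x + (F x).re < 0 := by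
      have := neg_mul_add_re_neg hR hF0 hreal hmono hx hx0
      rwa [hxε, Complex.ofReal_re] at this
    refine (((isBigO_sub_re_integral hR hF0 hball hw hδ hδR ε).add
      (IsBigO.of_bound D ?_ : (fun N : ℕ => ((N : ℂ) / (2 * Real.pi) * ∫ y in Set.Icc (-δ) δ,
        Complex.exp (N * F (y * Complex.I)) *
          Complex.exp (-(N * ε * y * Complex.I))).re) =O[atTop] _)).sub
      (isBigO_sqrt_mul_exp (hpos x hx) hentropy)).congr_left fun N => ?_
    · filter_upwards [eventually_ge_atTop 1] with N hN
      rw [Real.norm_of_nonneg (by positivity : (0 : ℝ) ≤ (N : ℝ) ^ (-(1 / 2) : ℝ)),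
        Real.norm_eq_abs]
      exact (Complex.abs_re_le_norm _).trans (by exact_mod_cast hD N (by exact_mod_cast hN))
    · ring
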